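/- Let $\mathcal M=(\mathcal S,\mathcal A,P,R,\gamma)$ be a discounted Markov decision process: $\mathcal S$ is a measurable space, $\mathcal A$ is a finite action set, $P$ is a Markov kernel from $\mathcal S\times\mathcal A$ to $\mathcal S$, $R(\cdot|s,a)$ is the reward distribution with mean $r(s,a)$ satisfying $|r(s,a)|\le R_{\max}<\infty$, and $\gamma\in[0,1)$. Let $\Pi$ be the set of Markovian stationary policies (Markov kernels from $\mathcal S$ to $\mathcal A$); $\pi\in\Pi$ is greedy w.r.t. $f$ if $\pi(\cdot|s)$ is carried by $\arg\max_a f(s,a)$ for every $s$. Let $$P^\delta(\mathcal B|s,a)=\int P(ds'|s,a)\,\delta_{(s',a)}(\mathcal B),\qquad P_k=(P^\delta)^{k-1}P,\qquad P_k^\pi(\mathcal B|s,a)=\int P_k(ds'|s,a)\int\pi(da'|s')\,\delta_{(s',a')}(\mathcal B).$$ For $k\ge1$ let $Q_k^\pi(s,a)=\mathbb E\big[\sum_{t\ge0}\gamma^t r(S_t,A_t)\,\big|\,S_0=s,A_0=a\big]$, where $S_{t+1}\sim P(\cdot|S_t,A_t)$ and, for $t\ge1$, $A_t\sim\pi(\cdot|S_t)$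 if $k$ divides $t$ and $A_t=A_{t-1}$ otherwise. Let $Q_k^*=\sup_{\pi\in\Pi}Q_k^\pi$ (pointwise), and let $\pi_k^*$ be any policy greedy w.r.t. $Q_k^*$. Put $$(T^*f)(s,a)=r(s,a)+\gamma\int P(ds'|s,a)\max_{a'}f(s',a'),\qquad (T^\delta f)(s,a)=r(s,a)+\gamma\,(P^\delta f)(s,a).$$ Let $\rho,\nu$ be probability measures on $\mathcal S\times\mathcal A$ and $q\in[1,\infty]$. For a probability measure $\mu$ on $\mathcal S\times\mathcal A$ let $\|\mu\|_{(q)}=\big\|\tfrac{d\mu}{d\nu}\big\|_{L_{q/(q-1)}(\nu)}$ if $\mu\ll\nu$ and $\|\mu\|_{(q)}=+\infty$ otherwise (where $q/(q-1)$ is $\infty$ for $q=1$ and $1$ for $q=\infty$). For $m_1,m_2,m_3\ge0$, $L\ge1$ and policies $\pi,\pi^{(1)},\dots,\pi^{(L)}$, the persistent concentrability coefficients are $$c_1(m_1,m_2,m_3;\pi)=\big\|\rho(P_k^{\pi})^{m_1}(P_k^{\pi_k^*})^{m_2}(P^\delta)^{m_3}\big\|_{(q)},$$ $$c_2(m_1,m_2;\pi^{(1)},\dots,\pi^{(L)})=\big\|\rho(P_k^{\pi^{(L)}})^{m_1}P_k^{\pi^{(L-1)}}\cdots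 P_k^{\pi^{(1)}}(P^\delta)^{m_2}\big\|_{(q)}.$$ Let $p\ge1$ be real, let $k,J\ge1$ be integers with $k\mid J$, and let $r\in[0,1]$. Let $Q^{(0)},\dots,Q^{(J)}$ be measurable functions on $\mathcal S\times\mathcal A$ with $|Q^{(j)}|\le Q_{\max}\le R_{\max}/(1-\gamma)$. For $0\le j<J$ let $\epsilon^{(j)}=T^*Q^{(j)}-Q^{(j+1)}$ if $k\mid j$ and $\epsilon^{(j)}=T^\delta Q^{(j)}-Q^{(j+1)}$ otherwise. Let $\pi^{(J)}$ be any policy greedy w.r.t. $Q^{(J)}$. With $\alpha_j=\frac{(1-\gamma)\gamma^{J-j-1}}{1-\gamma^{J+1}}$ and $d_j=\lfloor j/k\rfloor$, set $$C_{\mathrm{VI},\rho,\nu}(J;r,q)=\Big(\frac{1-\gamma^k}{2}\Big)^2\sup_{\pi_0,\dots,\pi_J\in\Pi}\sum_{j=0}^{J-1}\alpha_j^{2(1-r)}\Big(\sum_{m=0}^\infty\gamma^{km}\Big[c_1\big(m,\tfrac Jk-d_j,k-1-(j\bmod k);\pi_J\big)+c_2\big(m+1,k-1-(j\bmod k);\pi_{k(d_j+1)},\pi_{k(d_j+2)},\dots,\pi_J\big)\Big]\Big)^2,$$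 $$\mathcal E(\epsilon^{(0)},\dots,\epsilon^{(J-1)};r,q)=\sum_{j=0}^{J-1}\alpha_j^{2r}\,\|\epsilon^{(j)}\|_{pq,\nu}^{2p}.$$ Then $$\|Q_k^*-Q_k^{\pi^{(J)}}\|_{p,\rho}\le\frac{2\gamma^k}{(1-\gamma)(1-\gamma^k)}\Big[\frac{2}{1-\gamma}\gamma^{J/p}R_{\max}+C_{\mathrm{VI},\rho,\nu}(J;r,q)^{\frac1{2p}}\,\mathcal E(\epsilon^{(0)},\dots,\epsilon^{(J-1)};r,q)^{\frac1{2p}}\Big],$$ where nothing is claimed if $C_{\mathrm{VI},\rho,\nu}(J;r,q)=+\infty$ and $\mathcal E=0$ (the right-hand side is then read as $+\infty$). -/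

import Mathlib

open MeasureTheory ProbabilityTheory
open scoped ENNReal ProbabilityTheory

/-- A discounted Markov decision process on measurable spaces of states `S` and actions `A`:
transition kernel `P`, reward distribution `R` with finite mean, discount factor `γ ∈ [0,1)`. -/
structure MDP (S A : Type*) [MeasurableSpace S] [MeasurableSpace A] where
  P : Kernel (S × A) S
  markov_P : IsMarkovKernel P
  R : Kernel (S × A) ℝ
  markov_R : IsMarkovKernel R
  integrable_R : ∀ x, Integrable (fun y : ℝ => y) (R x)
  γ : ℝ
  γ_nonneg : 0 ≤ γ
  γ_lt_one : γ < 1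

/-- A Markovian stationary policy. -/
structure Policy (S A : Type*) [MeasurableSpace S] [MeasurableSpace A] where
  kernel : Kernel S A
  markov : IsMarkovKernel kernel

attribute [instance] MDP.markov_P MDP.markov_R Policy.markov

noncomputable section

/-- `π` is greedy with respect to `f`: in each state it plays only maximizers of `f (s, ·)`. -/
def Policy.IsGreedy {S A : Type*} [MeasurableSpace S] [MeasurableSpace A]
    (π : Policy S A) (f : S × A → ℝ) : Prop :=
  ∀ s, π.kernel s {a | ∀ a', f (s, a') ≤ f (s, a)} = 1

namespace MDP

variable {S A : Type*} [MeasurableSpace S] [MeasurableSpace A] (M : MDP S A)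

/-- The expected reward `r(s,a)`. -/
def r (x : S × A) : ℝ := ∫ y, y ∂(M.R x)

/-- The persistent state-action kernel `P^δ`: the state moves by `P`, the action is repeated. -/
def Pδ : Kernel (S × A) (S × A) :=
  M.P ×ₖ Kernel.deterministic Prod.snd measurable_snd

/-- The `k`-persistent transition kernel `P_k = (P^δ)^(k-1) P`
(first `k - 1` steps of `P^δ`, then one step of `P`). -/
def Pk (k : ℕ) : Kernel (S × A) S := M.P ∘ₖ (M.Pδ ^ (k - 1))

/-- The state-action kernel `P_k^π` of the `k`-persistent MDP:
the state moves by `P_k`, and the next action is drawn from `π`. -/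
def Pkπ (k : ℕ) (π : Policy S A) : Kernel (S × A) (S × A) :=
  M.Pk k ⊗ₖ Kernel.prodMkLeft (S × A) π.kernel

/-- The Bellman optimal operator `T^*`. -/
def Topt (f : S × A → ℝ) (x : S × A) : ℝ :=
  M.r x + M.γ * ∫ s', (⨆ a' : A, f (s', a')) ∂(M.P x)

/-- The Bellman persistent operator `T^δ`. -/
def Tδ (f : S × A → ℝ) (x : S × A) : ℝ :=
  M.r x + M.γ * ∫ y, f y ∂(M.Pδ x)

end MDP

section Execution

variable {S A : Type*} [MeasurableSpace S] [MeasurableSpace A]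

/-- The `k`-persistent policy induced by `π`, at time `t = n + 1`. It maps a history
`(S_0, A_0, …, S_n, A_n, S_{n+1})` to a distribution of `A_{n+1}`: a fresh draw from
`π(·|S_{n+1})` if `k ∣ n + 1`, and the previous action `A_n` otherwise. -/
def Policy.persist (π : Policy S A) (k n : ℕ) :
    Kernel ((Π _ : Finset.Iic n, S × A) × S) A :=
  if (n + 1) % k = 0 then π.kernel.comap Prod.snd measurable_snd
  else Kernel.deterministic (fun h => (h.1 ⟨n, Finset.mem_Iic.2 le_rfl⟩).2) (by fun_prop)

instance Policy.persist_markov (π : Policy S A) (k n : ℕ) :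
    IsMarkovKernel (π.persist k n) := by
  unfold Policy.persist
  split_ifs <;> infer_instance

namespace MDP

variable (M : MDP S A)

/-- The conditional law of `(S_{n+1}, A_{n+1})` given `(S_0, A_0, …, S_n, A_n)` when `π` is
executed at persistence `k` in the MDP `M`. -/
def step (k : ℕ) (π : Policy S A) (n : ℕ) : Kernel (Π _ : Finset.Iic n, S × A) (S × A) :=
  (M.P.comap (fun h => h ⟨n, Finset.mem_Iic.2 le_rfl⟩) (by fun_prop)) ⊗ₖ π.persist k n

instance step_markov (k : ℕ) (π : Policy S A) (n : ℕ) : IsMarkovKernel (M.step k π n) := by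
  unfold MDP.step
  infer_instance

/-- The law of the whole trajectory `(S_t, A_t)_{t ∈ ℕ}` started at `(S_0, A_0) = x`, when `π` is
executed at persistence `k` in the MDP `M`. -/
def law (k : ℕ) (π : Policy S A) (x : S × A) : Measure (ℕ → S × A) :=
  Kernel.traj (X := fun _ => S × A) (M.step k π) 0 (fun _ => x)

/-- The `k`-persistent action-value function `Q_k^π`: the expected discounted reward collected
in `M` by `π` executed at persistence `k`. -/
def Qπ (k : ℕ) (π : Policy S A) (x : S × A) : ℝ :=
  ∫ ω, (∑' t : ℕ, M.γ ^ t * M.r (ω t)) ∂(M.law k π x)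

/-- The `k`-persistent optimal action-value function `Q_k^* = sup_π Q_k^π`. -/
def Qopt (k : ℕ) (x : S × A) : ℝ := ⨆ π : Policy S A, M.Qπ k π x

/-- The approximation errors `ε^(j)` of a sequence of iterates `Q^(j)`. -/
def err (k : ℕ) (Q : ℕ → S × A → ℝ) (j : ℕ) (x : S × A) : ℝ :=
  if j % k = 0 then M.Topt (Q j) x - Q (j + 1) x else M.Tδ (Q j) x - Q (j + 1) x

end MDP

end Execution

section Concentrability

open Classical in
/-- `(E_ν |dμ/dν|^(q/(q-1)))^((q-1)/q)`, and `∞` if `μ` is not absolutely continuous with respect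
to `ν`. The conjugate exponent is `∞` (an essential supremum) for `q = 1`, and `1` for `q = ∞`. -/
def densityNorm {X : Type*} [MeasurableSpace X] (q : ℝ≥0∞) (μ ν : Measure X) : ℝ≥0∞ :=
  if μ ≪ ν then eLpNorm (μ.rnDeriv ν) q.conjExponent ν else ⊤

namespace MDP

variable {S A : Type*} [MeasurableSpace S] [MeasurableSpace A] (M : MDP S A)

/-- First persistent concentrability coefficient: the density norm of
`ρ (P_k^π)^m₁ (P_k^{π*})^m₂ (P^δ)^m₃` with respect to `ν`. -/
def cVI₁ (k : ℕ) (q : ℝ≥0∞) (ρ ν : Measure (S × A)) (πstar : Policy S A)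
    (m₁ m₂ m₃ : ℕ) (π : Policy S A) : ℝ≥0∞ :=
  densityNorm q
    (((ρ.bind ⇑(M.Pkπ k π ^ m₁)).bind ⇑(M.Pkπ k πstar ^ m₂)).bind ⇑(M.Pδ ^ m₃)) ν

/-- `chain k π n μ = μ P_k^{π n} P_k^{π (n-1)} ⋯ P_k^{π 1}`. -/
def chain (k : ℕ) (π : ℕ → Policy S A) : ℕ → Measure (S × A) → Measure (S × A)
  | 0, μ => μ
  | n + 1, μ => chain k π n (μ.bind (M.Pkπ k (π (n + 1))))

/-- Second persistent concentrability coefficient of the policies `π 1, …, π L` (`L ≥ 1`): the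
density norm of `ρ (P_k^{π L})^m₁ P_k^{π (L-1)} ⋯ P_k^{π 1} (P^δ)^m₂` with respect to `ν`. -/
def cVI₂ (k : ℕ) (q : ℝ≥0∞) (ρ ν : Measure (S × A)) (m₁ m₂ L : ℕ)
    (π : ℕ → Policy S A) : ℝ≥0∞ :=
  densityNorm q
    ((M.chain k π (L - 1) (ρ.bind ⇑(M.Pkπ k (π L) ^ m₁))).bind ⇑(M.Pδ ^ m₂)) ν

/-- The weights `α_j`, `0 ≤ j < J`. -/
def α (J j : ℕ) : ℝ := (1 - M.γ) * M.γ ^ (J - j - 1) / (1 - M.γ ^ (J + 1))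

/-- `C_{VI,ρ,ν}(J; r, q)`. The supremum runs over sequences `π_0, …, π_J` of policies (later
entries of `π` play no role). For the error made at step `j` the policies in force afterwards are
`π_{k (j/k + 1)}, π_{k (j/k + 2)}, …, π_J`, which are `J/k - j/k` many. -/
def CVI (k : ℕ) (πstar : Policy S A) (ρ ν : Measure (S × A)) (J : ℕ) (r : ℝ) (q : ℝ≥0∞) :
    ℝ≥0∞ :=
  ENNReal.ofReal ((1 - M.γ ^ k) / 2) ^ 2 *
    ⨆ π : ℕ → Policy S A, ∑ j ∈ Finset.range J,
      ENNReal.ofReal (M.α J j) ^ (2 * (1 - r)) *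
        (∑' m : ℕ, ENNReal.ofReal (M.γ ^ (k * m)) *
          (M.cVI₁ k q ρ ν πstar m (J / k - j / k) (k - j % k - 1) (π J) +
            M.cVI₂ k q ρ ν (m + 1) (k - j % k - 1) (J / k - j / k)
              (fun l => π (k * (j / k + l))))) ^ 2

/-- `𝓔(ε^(0), …, ε^(J-1); r, q) = ∑_j α_j^(2r) ‖ε^(j)‖_{pq,ν}^(2p)`. -/
def errAgg (p : ℝ) (ν : Measure (S × A)) (J : ℕ) (ε : ℕ → S × A → ℝ) (r : ℝ) (q : ℝ≥0∞) :
    ℝ≥0∞ :=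
  ∑ j ∈ Finset.range J,
    ENNReal.ofReal (M.α J j) ^ (2 * r) * eLpNorm (ε j) (ENNReal.ofReal p * q) ν ^ (2 * p)

end MDP

end Concentrability

end

noncomputable section

/-! Sampled every `k` steps, the persistent process is an ordinary discounted decision process with
kernel `Pk k`, reward `rk k` and discount `γ ^ k`. Its optimality operator `Tk k` is `T^*` followed
by `k - 1` applications of `T^δ` (`Tk_one`, `Tδ_Tk`), so `k` consecutive iterates form one
approximate application of `Tk k`, whose error is a discounted sum of the single errors carried by
powers of `P^δ` (`enorm_Tk_sub_le`). `Qopt k` is the fixed point of `Tk k`, attained by any policy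
greedy for it.

The positive parts of `Qopt - Q^(kd)` and `Q^(kd) - Qopt` obey separate linear recursions, one along
`π*` and one along the greedy policies of the iterates. The performance loss obeys a third, along
the final policy, with these two parts as source (`ofReal_Qopt_sub_Qπ_le`). Unrolling all three
bounds the loss pointwise by a superposition of the errors and of the initial gap, pushed through
Markov kernels (`ofReal_Qopt_sub_Qπ_le_tsum`).

Apart from an outer factor `γ ^ k`, the total weight of this superposition is `2 (1 - γ^(J+1)) / ((1
- γ)(1 - γ^k))`. Jensen's inequality with these weights bounds the `p`-th moment, Hölder's
inequality replaces each transported measure by `ν` at the price of a density norm, and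
Cauchy–Schwarz over the iterates, with `α = α^(1-r) α^r`, separates the coefficients from the
errors. -/

instance isMarkovKernel_pow {X : Type*} [MeasurableSpace X] (κ : Kernel X X) [IsMarkovKernel κ]
    (n : ℕ) : IsMarkovKernel (κ ^ n) := by
  induction n with
  | zero => rw [pow_zero]; exact inferInstanceAs (IsMarkovKernel (Kernel.id : Kernel X X))
  | succ n ih => rw [pow_succ]; exact inferInstanceAs (IsMarkovKernel ((κ ^ n) ∘ₖ κ))

/-! ### Bounded measurable functions under kernels. -/

/-- Bounded measurable real functions. -/
structure BddMeasurable {X : Type*} [MeasurableSpace X] (f : X → ℝ) : Prop where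
  measurable : Measurable f
  bdd : ∃ C, ∀ x, |f x| ≤ C

namespace BddMeasurable

variable {X Y : Type*} [MeasurableSpace X] [MeasurableSpace Y] {f g : X → ℝ}

lemma integrable (hf : BddMeasurable f) (μ : Measure X) [IsFiniteMeasure μ] :
    Integrable f μ := by
  obtain ⟨C, hC⟩ := hf.bdd
  exact Integrable.of_bound hf.measurable.aestronglyMeasurable C (.of_forall hC)

lemma add (hf : BddMeasurable f) (hg : BddMeasurable g) : BddMeasurable fun x => f x + g x := by
  obtain ⟨C, hC⟩ := hf.bdd
  obtain ⟨D, hD⟩ := hg.bdd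
  exact ⟨hf.measurable.add hg.measurable,
    C + D, fun x => (abs_add_le _ _).trans (add_le_add (hC x) (hD x))⟩

lemma neg (hf : BddMeasurable f) : BddMeasurable fun x => -f x := by
  obtain ⟨C, hC⟩ := hf.bdd
  exact ⟨hf.measurable.neg, C, fun x => by rw [abs_neg]; exact hC x⟩

lemma sub (hf : BddMeasurable f) (hg : BddMeasurable g) : BddMeasurable fun x => f x - g x := by
  simpa only [sub_eq_add_neg] using hf.add hg.neg

lemma const_mul (hf : BddMeasurable f) (c : ℝ) : BddMeasurable fun x => c * f x := by
  obtain ⟨C, hC⟩ := hf.bdd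
  exact ⟨hf.measurable.const_mul c, |c| * C, fun x => by
    rw [abs_mul]; exact mul_le_mul_of_nonneg_left (hC x) (abs_nonneg c)⟩

lemma zero : BddMeasurable fun _ : X => (0 : ℝ) := ⟨measurable_const, 0, by simp⟩

lemma sum {ι : Type*} (s : Finset ι) {F : ι → X → ℝ} (hF : ∀ i ∈ s, BddMeasurable (F i)) :
    BddMeasurable fun x => ∑ i ∈ s, F i x := by
  classical
  induction s using Finset.induction_on with
  | empty => simpa using BddMeasurable.zero
  | insert a s ha ih =>
    simp only [Finset.sum_insert ha]
    exact (hF a (Finset.mem_insert_self a s)).add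
      (ih fun i hi => hF i (Finset.mem_insert_of_mem hi))

end BddMeasurable

lemma abs_integral_le_of_abs_le {X : Type*} [MeasurableSpace X] {f : X → ℝ} {C : ℝ}
    (hC : ∀ x, |f x| ≤ C) (μ : Measure X) [IsProbabilityMeasure μ] : |∫ x, f x ∂μ| ≤ C := by
  have := norm_integral_le_of_norm_le_const (μ := μ) (f := f) (C := C) (.of_forall hC)
  simpa using this

namespace BddMeasurable

variable {X Y : Type*} [MeasurableSpace X] [MeasurableSpace Y]

lemma integral_kernel {f : Y → ℝ} (hf : BddMeasurable f) (κ : Kernel X Y) [IsMarkovKernel κ] :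
    BddMeasurable fun x => ∫ y, f y ∂κ x := by
  obtain ⟨C, hC⟩ := hf.bdd
  exact ⟨(hf.measurable.stronglyMeasurable.integral_kernel).measurable, C,
    fun x => abs_integral_le_of_abs_le hC _⟩

lemma comp_prodMk {f : X × Y → ℝ} (hf : BddMeasurable f) (x : X) :
    BddMeasurable fun y => f (x, y) := by
  obtain ⟨C, hC⟩ := hf.bdd
  exact ⟨hf.measurable.comp measurable_prodMk_left, C, fun y => hC _⟩

lemma iSup_snd [Finite Y] [Nonempty Y] {f : X × Y → ℝ} (hf : BddMeasurable f) :
    BddMeasurable fun x => ⨆ y, f (x, y) := by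
  obtain ⟨C, hC⟩ := hf.bdd
  refine ⟨Measurable.iSup fun y => hf.measurable.comp measurable_prodMk_right, C, fun x => ?_⟩
  rw [abs_le]
  obtain ⟨y⟩ := ‹Nonempty Y›
  exact ⟨(neg_le_of_abs_le (hC (x, y))).trans (le_ciSup (f := fun y => f (x, y))
    (Set.finite_range _).bddAbove y),
    haveI : Nonempty Y := ⟨y⟩
    ciSup_le fun y => le_of_abs_le (hC (x, y))⟩

end BddMeasurable

/-! ### Time marginals of the persistent execution and the expectation equation. -/

namespace MDP

variable {S A : Type*} [MeasurableSpace S] [MeasurableSpace A] (M : MDP S A)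

instance isMarkovKernel_Pδ : IsMarkovKernel M.Pδ := by unfold Pδ; infer_instance

instance isMarkovKernel_Pk (k : ℕ) : IsMarkovKernel (M.Pk k) := by unfold Pk; infer_instance

instance isMarkovKernel_Pkπ (k : ℕ) (π : Policy S A) : IsMarkovKernel (M.Pkπ k π) := by
  unfold Pkπ; infer_instance

lemma bddMeasurable_r {Rmax : ℝ} (hR : ∀ x, |M.r x| ≤ Rmax) : BddMeasurable M.r :=
  ⟨(measurable_id.stronglyMeasurable.integral_kernel (κ := M.R)).measurable, Rmax, hR⟩

lemma Pkπ_one_comp (k : ℕ) (π : Policy S A) :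
    M.Pkπ 1 π ∘ₖ (M.Pδ ^ (k - 1)) = M.Pkπ k π := by
  have h1 : M.Pk 1 = M.P := Kernel.comp_id _
  rw [Pkπ, Pkπ, h1, Kernel.compProd_prodMkLeft_eq_comp, Kernel.compProd_prodMkLeft_eq_comp,
    Kernel.comp_assoc, Pk]

/-- The one-step kernel of the state-action process at time `t ≥ 1`. -/
def stepKernel (k : ℕ) (π : Policy S A) (t : ℕ) : Kernel (S × A) (S × A) :=
  if t % k = 0 then M.Pkπ 1 π else M.Pδ

instance isMarkovKernel_stepKernel (k : ℕ) (π : Policy S A) (t : ℕ) :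
    IsMarkovKernel (M.stepKernel k π t) := by
  unfold stepKernel; split_ifs <;> infer_instance

/-- Whether the action is repeated depends only on the time, and the repeated action is part of the
current pair. Hence `(S_t, A_t)` is a time-inhomogeneous Markov chain, although the policy reads a
history. -/
lemma step_eq_comap (k : ℕ) (π : Policy S A) (n : ℕ) :
    M.step k π n =
      (M.stepKernel k π (n + 1)).comap (fun h => h ⟨n, Finset.mem_Iic.2 le_rfl⟩)
        (by fun_prop) := by
  have h1 : M.Pk 1 = M.P := Kernel.comp_id _
  ext h s hs
  unfold step stepKernel
  rw [Kernel.compProd_apply hs, Kernel.comap_apply, Kernel.comap_apply]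
  split_ifs with hn
  · rw [Pkπ, h1, Kernel.compProd_apply hs]
    simp [Policy.persist, hn, Kernel.comap_apply]
  · rw [Pδ, Kernel.prod_apply' _ _ _ hs]
    simp [Policy.persist, hn, Kernel.deterministic_apply]

/-- The law of `(S_t, A_t)` given `(S_0, A_0)`. -/
def marginal (k : ℕ) (π : Policy S A) : ℕ → Kernel (S × A) (S × A)
  | 0 => Kernel.id
  | t + 1 => M.stepKernel k π (t + 1) ∘ₖ marginal k π t

instance isMarkovKernel_marginal (k : ℕ) (π : Policy S A) (t : ℕ) :
    IsMarkovKernel (M.marginal k π t) := by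
  induction t with
  | zero => unfold marginal; infer_instance
  | succ t ih => unfold marginal; infer_instance

instance isProbabilityMeasure_law (k : ℕ) (π : Policy S A) (x : S × A) :
    IsProbabilityMeasure (M.law k π x) := by unfold law; infer_instance

/-- The trajectory law disintegrates over the history up to `t`, and the next step reads only its
last entry, so the recursion closes on one-time marginals. -/
lemma law_map_eval (k : ℕ) (π : Policy S A) (x : S × A) (t : ℕ) :
    (M.law k π x).map (fun ω => ω t) = M.marginal k π t x := by
  have hrestr (t : ℕ) : (M.law k π x).map (fun ω => ω t) =
      (Kernel.partialTraj (X := fun _ => S × A) (M.step k π) 0 t (fun _ => x)).map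
        (fun h => h ⟨t, Finset.mem_Iic.2 le_rfl⟩) := by
    rw [law, ← Kernel.traj_map_frestrictLe_apply, Measure.map_map (by fun_prop) (by fun_prop)]
    rfl
  induction t with
  | zero =>
    rw [hrestr, Kernel.partialTraj_self, Kernel.id_apply, Measure.map_dirac' (by fun_prop),
      marginal, Kernel.id_apply]
  | succ t ih =>
    have h1 := Kernel.partialTraj_compProd_eq_map_traj (X := fun _ => S × A) (κ := M.step k π)
      (Nat.zero_le t) (x₀ := fun _ => x)
    have h2 : (M.law k π x).map (fun ω => ω (t + 1)) = (M.step k π t) ∘ₘ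
        (Kernel.partialTraj (X := fun _ => S × A) (M.step k π) 0 t (fun _ => x)) := by
      rw [← Measure.snd_compProd, h1, Measure.snd, Measure.map_map measurable_snd (by fun_prop)]
      rfl
    rw [h2, marginal, Kernel.comp_apply, ← ih, hrestr]
    ext s hs
    rw [Measure.bind_apply hs (Kernel.aemeasurable _), Measure.bind_apply hs
      (Kernel.aemeasurable _), lintegral_map (Kernel.measurable_coe _ hs) (by fun_prop),
      step_eq_comap]
    rfl

lemma marginal_eq_pow (k : ℕ) (π : Policy S A) (t : ℕ) (ht : t < k) :
    M.marginal k π t = M.Pδ ^ t := by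
  induction t with
  | zero => rfl
  | succ t ih =>
    rw [marginal, ih (by omega), stepKernel, if_neg (by rw [Nat.mod_eq_of_lt ht]; omega), pow_succ']
    rfl

/-- The step kernels are `k`-periodic in time, and one full period, `k - 1` repetitions followed by
a fresh draw, composes to `Pkπ k π`. -/
lemma marginal_add (k : ℕ) (hk : 1 ≤ k) (π : Policy S A) (t : ℕ) :
    M.marginal k π (t + k) = M.marginal k π t ∘ₖ M.Pkπ k π := by
  induction t with
  | zero =>
    obtain ⟨n, rfl⟩ : ∃ n, k = n + 1 := ⟨k - 1, by omega⟩
    have h0 : M.marginal (n + 1) π 0 = Kernel.id := rfl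
    rw [zero_add, h0, marginal, marginal_eq_pow _ (n + 1) _ n (Nat.lt_succ_self n), stepKernel,
      if_pos (Nat.mod_self _), Kernel.id_comp, ← Pkπ_one_comp _ (n + 1), Nat.add_sub_cancel]
  | succ t ih =>
    rw [show t + 1 + k = t + k + 1 by ring, marginal, ih, marginal, Kernel.comp_assoc, stepKernel,
      stepKernel]
    congr 2
    rw [show t + k + 1 = t + 1 + k by ring, Nat.add_mod_right]

/-- The expected discounted reward collected in the first `n` steps under a repeated action. -/
def rk (n : ℕ) (x : S × A) : ℝ := ∑ t ∈ Finset.range n, M.γ ^ t * ∫ y, M.r y ∂((M.Pδ ^ t) x)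

variable {M} {Rmax : ℝ}

lemma bddMeasurable_rk (hR : ∀ x, |M.r x| ≤ Rmax) (n : ℕ) : BddMeasurable (M.rk n) :=
  BddMeasurable.sum _ fun _ _ => ((M.bddMeasurable_r hR).integral_kernel _).const_mul _

lemma hasSum_Qπ (hR : ∀ x, |M.r x| ≤ Rmax) (k : ℕ) (π : Policy S A) (x : S × A) :
    HasSum (fun t => M.γ ^ t * ∫ y, M.r y ∂(M.marginal k π t x)) (M.Qπ k π x) := by
  have hr := M.bddMeasurable_r hR
  have hRnn : 0 ≤ Rmax := (abs_nonneg _).trans (hR x)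
  have hint (t : ℕ) : Integrable (fun ω : ℕ → S × A => M.γ ^ t * M.r (ω t)) (M.law k π x) := by
    have : BddMeasurable fun ω : ℕ → S × A => M.r (ω t) :=
      ⟨hr.measurable.comp (measurable_pi_apply t), Rmax, fun ω => hR _⟩
    exact (this.const_mul _).integrable _
  have heq (t : ℕ) : ∫ ω, M.γ ^ t * M.r (ω t) ∂(M.law k π x) =
      M.γ ^ t * ∫ y, M.r y ∂(M.marginal k π t x) := by
    rw [integral_const_mul, ← law_map_eval, integral_map (measurable_pi_apply t).aemeasurable
      hr.measurable.aestronglyMeasurable]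
  have := hasSum_integral_of_summable_integral_norm hint (by
    refine Summable.of_nonneg_of_le (fun t => integral_nonneg fun ω => norm_nonneg _) (fun t => ?_)
      ((summable_geometric_of_lt_one M.γ_nonneg M.γ_lt_one).mul_right Rmax)
    refine (le_abs_self _).trans (abs_integral_le_of_abs_le (fun ω => ?_) _)
    rw [Real.norm_eq_abs, abs_abs, abs_mul, abs_of_nonneg (pow_nonneg M.γ_nonneg t)]
    exact mul_le_mul_of_nonneg_left (hR _) (pow_nonneg M.γ_nonneg t))
  simp only [heq] at this
  exact this

lemma abs_Qπ_le (hR : ∀ x, |M.r x| ≤ Rmax) (k : ℕ) (π : Policy S A) (x : S × A) :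
    |M.Qπ k π x| ≤ Rmax / (1 - M.γ) := by
  have h := hasSum_Qπ hR k π x
  have hg := (hasSum_geometric_of_lt_one M.γ_nonneg M.γ_lt_one).mul_right Rmax
  rw [← h.tsum_eq, div_eq_inv_mul]
  refine tsum_of_norm_bounded (f := fun t => M.γ ^ t * ∫ y, M.r y ∂(M.marginal k π t x)) hg
    fun t => ?_
  rw [Real.norm_eq_abs, abs_mul, abs_of_nonneg (pow_nonneg M.γ_nonneg t)]
  exact mul_le_mul_of_nonneg_left (abs_integral_le_of_abs_le hR _) (pow_nonneg M.γ_nonneg t)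

lemma bddMeasurable_Qπ (hR : ∀ x, |M.r x| ≤ Rmax) (k : ℕ) (π : Policy S A) :
    BddMeasurable (M.Qπ k π) := by
  refine ⟨?_, _, abs_Qπ_le hR k π⟩
  refine measurable_of_tendsto_metrizable (f := fun n x =>
    ∑ t ∈ Finset.range n, M.γ ^ t * ∫ y, M.r y ∂(M.marginal k π t x)) (fun n => ?_)
    (tendsto_pi_nhds.2 fun x => (hasSum_Qπ hR k π x).tendsto_sum_nat)
  exact (BddMeasurable.sum _ fun t _ =>
    ((M.bddMeasurable_r hR).integral_kernel (M.marginal k π t)).const_mul (M.γ ^ t)).measurable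

/-- The Bellman expectation equation of the `k`-persistent process. -/
lemma Qπ_eq (hR : ∀ x, |M.r x| ≤ Rmax) {k : ℕ} (hk : 1 ≤ k) (π : Policy S A) (x : S × A) :
    M.Qπ k π x = M.rk k x + M.γ ^ k * ∫ y, M.Qπ k π y ∂(M.Pkπ k π x) := by
  have hr := M.bddMeasurable_r hR
  have h := hasSum_Qπ hR k π x
  -- Before time `k` only the initial action is played, which gives `rk k`; the tail is the same
  -- series started after one period.
  rw [← h.tsum_eq, ← h.summable.sum_add_tsum_nat_add k]
  congr 1
  · refine Finset.sum_congr rfl fun t ht => ?_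
    rw [marginal_eq_pow _ _ _ _ (Finset.mem_range.1 ht)]
  · have hint (t : ℕ) : Integrable (fun y => M.γ ^ t * ∫ z, M.r z ∂(M.marginal k π t y))
        (M.Pkπ k π x) := ((hr.integral_kernel _).const_mul _).integrable _
    have := hasSum_integral_of_summable_integral_norm hint (by
      refine Summable.of_nonneg_of_le (fun t => integral_nonneg fun ω => norm_nonneg _)
        (fun t => ?_) ((summable_geometric_of_lt_one M.γ_nonneg M.γ_lt_one).mul_right Rmax)
      refine (le_abs_self _).trans (abs_integral_le_of_abs_le (fun ω => ?_) _)
      rw [Real.norm_eq_abs, abs_abs, abs_mul, abs_of_nonneg (pow_nonneg M.γ_nonneg t)]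
      exact mul_le_mul_of_nonneg_left (abs_integral_le_of_abs_le hR _) (pow_nonneg M.γ_nonneg t))
    rw [show (fun y => M.Qπ k π y) = fun y => ∑' t, M.γ ^ t * ∫ z, M.r z ∂(M.marginal k π t y)
      from funext fun y => (hasSum_Qπ hR k π y).tsum_eq.symm, ← this.tsum_eq, ← tsum_mul_left]
    refine tsum_congr fun t => ?_
    rw [marginal_add _ _ hk, Kernel.integral_comp (hr.integrable _), integral_const_mul, pow_add]
    ring

end MDP

/-! ### Comparison principle, measurable greedy selection and the optimality equation. -/

/-- A bounded function dominated by a discounted average of itself is nonpositive. -/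
lemma nonpos_of_le_mul_integral {X : Type*} [MeasurableSpace X] (κ : Kernel X X)
    [IsMarkovKernel κ] {β : ℝ} (hβ0 : 0 ≤ β) (hβ1 : β < 1) {h : X → ℝ} (hh : BddMeasurable h)
    (hle : ∀ x, h x ≤ β * ∫ y, h y ∂κ x) (x : X) : h x ≤ 0 := by
  obtain ⟨C, hC⟩ := hh.bdd
  have key (n : ℕ) : ∀ x, h x ≤ β ^ n * C := by
    induction n with
    | zero => intro x; simpa using (le_abs_self _).trans (hC x)
    | succ n ih =>
      intro x
      refine (hle x).trans ?_
      rw [pow_succ', mul_assoc]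
      refine mul_le_mul_of_nonneg_left ?_ hβ0
      refine (integral_mono (hh.integrable _) (integrable_const _) ih).trans (by simp)
  have hlim : Filter.Tendsto (fun n : ℕ => β ^ n * C) Filter.atTop (nhds 0) := by
    simpa using (tendsto_pow_atTop_nhds_zero_of_lt_one hβ0 hβ1).mul_const C
  exact ge_of_tendsto' hlim fun n => key n x

lemma Policy.exists_isGreedy {S A : Type*} [MeasurableSpace S] [MeasurableSpace A]
    [Finite A] [MeasurableSingletonClass A] [Nonempty A] {f : S × A → ℝ} (hf : Measurable f) :
    ∃ π : Policy S A, π.IsGreedy f := by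
  classical
  -- An enumeration of the actions breaks ties measurably: the first maximizer in the list is
  -- selected.
  obtain ⟨e, he⟩ := exists_surjective_nat A
  have hex (s : S) : ∃ n, ∀ a', f (s, a') ≤ f (s, e n) := by
    obtain ⟨a, ha⟩ := Finite.exists_max fun a => f (s, a)
    obtain ⟨n, rfl⟩ := he a
    exact ⟨n, ha⟩
  have hmeas : Measurable fun s => e (Nat.find (hex s)) := by
    refine Measurable.find (f := fun n _ => e n) (p := fun n s => ∀ a', f (s, a') ≤ f (s, e n))
      (fun n => measurable_const) (fun n => ?_) hex
    rw [Set.ofPred_forall]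
    exact MeasurableSet.iInter fun a' => measurableSet_le
      (hf.comp measurable_prodMk_right) (hf.comp measurable_prodMk_right)
  refine ⟨⟨Kernel.deterministic _ hmeas, inferInstance⟩, fun s => ?_⟩
  rw [Kernel.deterministic_apply, Measure.dirac_apply' _ (Set.toFinite _).measurableSet,
    Set.indicator_of_mem]
  · rfl
  · exact Nat.find_spec (hex s)

namespace MDP

variable {S A : Type*} [MeasurableSpace S] [MeasurableSpace A]
 (M : MDP S A)

/-- The Bellman optimal operator of `n`-step transitions under a repeated action. -/
def Tk (n : ℕ) (f : S × A → ℝ) (x : S × A) : ℝ :=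
  M.rk n x + M.γ ^ n * ∫ s', (⨆ a' : A, f (s', a')) ∂(M.Pk n x)

variable {M} {Rmax : ℝ}

lemma integral_Pkπ (k : ℕ) (π : Policy S A) {f : S × A → ℝ} (hf : BddMeasurable f) (x : S × A) :
    ∫ y, f y ∂(M.Pkπ k π x) = ∫ s', ∫ a', f (s', a') ∂(π.kernel s') ∂(M.Pk k x) := by
  have h := hf.integrable (M.Pkπ k π x)
  rw [Pkπ] at h ⊢
  rw [ProbabilityTheory.integral_compProd h]
  rfl

lemma γ_pow_lt_one {k : ℕ} (hk : 1 ≤ k) : M.γ ^ k < 1 :=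
  pow_lt_one₀ M.γ_nonneg M.γ_lt_one (by omega)

lemma bddMeasurable_integral_policy (π : Policy S A) {f : S × A → ℝ} (hf : BddMeasurable f) :
    BddMeasurable fun s => ∫ a, f (s, a) ∂(π.kernel s) := by
  obtain ⟨C, hC⟩ := hf.bdd
  refine ⟨?_, C, fun s => abs_integral_le_of_abs_le (fun a => hC (s, a)) _⟩
  exact (StronglyMeasurable.integral_kernel_prod_right' (κ := π.kernel)
    hf.measurable.stronglyMeasurable).measurable

variable [Finite A]

lemma integral_policy_le (π : Policy S A) {f : S × A → ℝ} (hf : BddMeasurable f) (s : S) :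
    ∫ a, f (s, a) ∂(π.kernel s) ≤ ⨆ a, f (s, a) := by
  refine (integral_mono ((hf.comp_prodMk s).integrable _) (integrable_const _)
    (Finite.le_ciSup fun a => f (s, a))).trans (by simp)

variable [Nonempty A]

lemma bddMeasurable_Tk (hR : ∀ x, |M.r x| ≤ Rmax) (n : ℕ) {f : S × A → ℝ}
    (hf : BddMeasurable f) : BddMeasurable (M.Tk n f) :=
  (bddMeasurable_rk hR n).add ((hf.iSup_snd.integral_kernel _).const_mul _)

lemma Tk_le_add (n : ℕ) {f g : S × A → ℝ} (hf : BddMeasurable f) (hg : BddMeasurable g) {C : ℝ}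
    (h : ∀ x, f x ≤ g x + C) (x : S × A) : M.Tk n f x ≤ M.Tk n g x + M.γ ^ n * C := by
  have h1 : ∫ s', (⨆ a' : A, f (s', a')) ∂(M.Pk n x) ≤
      ∫ s', ((⨆ a' : A, g (s', a')) + C) ∂(M.Pk n x) := by
    refine integral_mono (hf.iSup_snd.integrable _)
      ((hg.iSup_snd.integrable _).add (integrable_const C)) fun s => ?_
    exact ciSup_le fun a => (h (s, a)).trans
      (add_le_add_left (Finite.le_ciSup (fun a => g (s, a)) a) C)
  rw [integral_add (hg.iSup_snd.integrable _) (integrable_const C)] at h1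
  simp only [integral_const, probReal_univ, one_smul] at h1
  have := mul_le_mul_of_nonneg_left h1 (pow_nonneg M.γ_nonneg n)
  unfold Tk
  linarith

lemma abs_Tk_sub_le (n : ℕ) {f g : S × A → ℝ} (hf : BddMeasurable f) (hg : BddMeasurable g)
    {C : ℝ} (h : ∀ x, |f x - g x| ≤ C) (x : S × A) :
    |M.Tk n f x - M.Tk n g x| ≤ M.γ ^ n * C := by
  have h1 := M.Tk_le_add n hf hg (C := C) (fun x => by linarith [le_abs_self (f x - g x), h x]) x
  have h2 := M.Tk_le_add n hg hf (C := C) (fun x => by linarith [neg_abs_le (f x - g x), h x]) x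
  rw [abs_le]
  constructor <;> linarith

lemma integral_Pkπ_le (k : ℕ) (π : Policy S A) {f : S × A → ℝ} (hf : BddMeasurable f)
    (x : S × A) :
    ∫ y, f y ∂(M.Pkπ k π x) ≤ ∫ s', (⨆ a', f (s', a')) ∂(M.Pk k x) := by
  rw [integral_Pkπ k π hf]
  exact integral_mono ((bddMeasurable_integral_policy π hf).integrable _)
    (hf.iSup_snd.integrable _) fun s => integral_policy_le π hf s

/-- Picard iteration from `0`, carried out pointwise. The geometric rate is uniform in `x`, so the
limit is bounded and `Tk` passes to it; measurability comes from the pointwise limit. -/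
lemma exists_fixedPoint_Tk (hR : ∀ x, |M.r x| ≤ Rmax) {k : ℕ} (hk : 1 ≤ k) :
    ∃ W : S × A → ℝ, BddMeasurable W ∧ ∀ x, M.Tk k W x = W x := by
  set W : ℕ → S × A → ℝ := fun n => (M.Tk k)^[n] fun _ => 0 with hW
  have hsucc (n : ℕ) : W (n + 1) = M.Tk k (W n) := Function.iterate_succ_apply' _ _ _
  have hbdd (n : ℕ) : BddMeasurable (W n) := by
    induction n with
    | zero => exact BddMeasurable.zero
    | succ n ih => rw [hsucc]; exact bddMeasurable_Tk hR k ih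
  obtain ⟨C, hC⟩ := ((hbdd 0).sub (hbdd 1)).bdd
  set β := M.γ ^ k
  have hβ0 : 0 ≤ β := pow_nonneg M.γ_nonneg k
  have hβ1 : β < 1 := γ_pow_lt_one hk
  have hdist (n : ℕ) : ∀ x, |W n x - W (n + 1) x| ≤ β ^ n * C := by
    induction n with
    | zero => intro x; simpa using hC x
    | succ n ih =>
      intro x
      rw [hsucc n, hsucc (n + 1), pow_succ', mul_assoc]
      exact abs_Tk_sub_le k (hbdd n) (hbdd (n + 1)) ih x
  have hdist' (x : S × A) (n : ℕ) : dist (W n x) (W (n + 1) x) ≤ C * β ^ n := by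
    rw [Real.dist_eq, mul_comm]; exact hdist n x
  choose V hV using fun x => cauchySeq_tendsto_of_complete
    (cauchySeq_of_le_geometric β C hβ1 (hdist' x))
  have hWV (n : ℕ) (x : S × A) : |W n x - V x| ≤ C / (1 - β) * β ^ n := by
    have := dist_le_of_le_geometric_of_tendsto β C hβ1 (hdist' x) (hV x) n
    rw [Real.dist_eq] at this
    exact this.trans (le_of_eq (by ring))
  have hVb : BddMeasurable V := by
    refine ⟨measurable_of_tendsto_metrizable (fun n => (hbdd n).measurable)
      (tendsto_pi_nhds.2 hV), C / (1 - β), fun x => ?_⟩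
    have h0 := hWV 0 x
    have h1 : W 0 x = 0 := rfl
    rw [h1] at h0
    simpa using h0
  refine ⟨V, hVb, fun x => ?_⟩
  -- Comparing both terms with `Tk k (W n) = W (n + 1)` costs `β ^ (n + 1) * C / (1 - β)` each.
  have hle (n : ℕ) : |M.Tk k V x - V x| ≤ β ^ n * (2 * β * (C / (1 - β))) := by
    have h1 := abs_Tk_sub_le (M := M) k (hbdd n) hVb (hWV n) x
    have h2 := hWV (n + 1) x
    rw [hsucc] at h2
    calc |M.Tk k V x - V x| = |(M.Tk k (W n) x - V x) - (M.Tk k (W n) x - M.Tk k V x)| := by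
          congr 1; ring
      _ ≤ |M.Tk k (W n) x - V x| + |M.Tk k (W n) x - M.Tk k V x| := abs_sub _ _
      _ ≤ C / (1 - β) * β ^ (n + 1) + β * (C / (1 - β) * β ^ n) := add_le_add h2 h1
      _ = β ^ n * (2 * β * (C / (1 - β))) := by ring
  have hlim : Filter.Tendsto (fun n : ℕ => β ^ n * (2 * β * (C / (1 - β)))) Filter.atTop
      (nhds 0) := by
    simpa using (tendsto_pow_atTop_nhds_zero_of_lt_one hβ0 hβ1).mul_const (2 * β * (C / (1 - β)))
  have := ge_of_tendsto' hlim hle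
  exact sub_eq_zero.1 (abs_nonpos_iff.1 this)

lemma Qπ_le_fixedPoint (hR : ∀ x, |M.r x| ≤ Rmax) {k : ℕ} (hk : 1 ≤ k) {W : S × A → ℝ}
    (hW : BddMeasurable W) (hfix : ∀ x, M.Tk k W x = W x) (π : Policy S A) (x : S × A) :
    M.Qπ k π x ≤ W x := by
  have hQ := bddMeasurable_Qπ hR k π
  refine sub_nonpos.1 (nonpos_of_le_mul_integral (M.Pkπ k π) (pow_nonneg M.γ_nonneg k)
    (γ_pow_lt_one hk) (hQ.sub hW) (fun x => ?_) x)
  rw [Qπ_eq hR hk, ← hfix x, Tk, integral_sub (hQ.integrable _) (hW.integrable _), mul_sub]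
  have := mul_le_mul_of_nonneg_left (integral_Pkπ_le (M := M) k π hW x) (pow_nonneg M.γ_nonneg k)
  linarith

variable [MeasurableSingletonClass A]

lemma integral_Pkπ_of_isGreedy (k : ℕ) {π : Policy S A} {f : S × A → ℝ} (hf : BddMeasurable f)
    (hπ : π.IsGreedy f) (x : S × A) :
    ∫ y, f y ∂(M.Pkπ k π x) = ∫ s', (⨆ a', f (s', a')) ∂(M.Pk k x) := by
  rw [integral_Pkπ k π hf]
  congr 1 with s
  have hae : ∀ᵐ a ∂(π.kernel s), f (s, a) = ⨆ a', f (s, a') := by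
    have h1 : ∀ᵐ a ∂(π.kernel s), a ∈ {a | ∀ a', f (s, a') ≤ f (s, a)} :=
      (prob_compl_eq_zero_iff (Set.toFinite _).measurableSet).2 (hπ s)
    filter_upwards [h1] with a ha
    exact le_antisymm (Finite.le_ciSup (fun a => f (s, a)) a) (ciSup_le ha)
  rw [integral_congr_ae hae]
  simp

lemma fixedPoint_le_Qπ (hR : ∀ x, |M.r x| ≤ Rmax) {k : ℕ} (hk : 1 ≤ k) {W : S × A → ℝ}
    (hW : BddMeasurable W) (hfix : ∀ x, M.Tk k W x = W x) {π : Policy S A} (hπ : π.IsGreedy W)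
    (x : S × A) : W x ≤ M.Qπ k π x := by
  have hQ := bddMeasurable_Qπ hR k π
  refine sub_nonpos.1 (nonpos_of_le_mul_integral (M.Pkπ k π) (pow_nonneg M.γ_nonneg k)
    (γ_pow_lt_one hk) (hW.sub hQ) (fun x => ?_) x)
  rw [Qπ_eq hR hk, ← hfix x, Tk, integral_sub (hW.integrable _) (hQ.integrable _), mul_sub,
    integral_Pkπ_of_isGreedy k hW hπ]
  simp

/-- Every policy value lies below the fixed point, and a policy greedy for it attains it at all
points at once. This is also how a supremum over possibly uncountably many policies is seen to be
measurable. -/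
lemma Qopt_eq_fixedPoint (hR : ∀ x, |M.r x| ≤ Rmax) {k : ℕ} (hk : 1 ≤ k) {W : S × A → ℝ}
    (hW : BddMeasurable W) (hfix : ∀ x, M.Tk k W x = W x) : M.Qopt k = W := by
  obtain ⟨π, hπ⟩ := Policy.exists_isGreedy hW.measurable
  ext x
  have : Nonempty (Policy S A) := ⟨π⟩
  refine le_antisymm (ciSup_le fun π' => Qπ_le_fixedPoint hR hk hW hfix π' x) ?_
  exact (fixedPoint_le_Qπ hR hk hW hfix hπ x).trans (le_ciSup (f := fun π' => M.Qπ k π' x)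
    ⟨W x, by rintro _ ⟨π', rfl⟩; exact Qπ_le_fixedPoint hR hk hW hfix π' x⟩ π)

lemma bddMeasurable_Qopt (hR : ∀ x, |M.r x| ≤ Rmax) {k : ℕ} (hk : 1 ≤ k) :
    BddMeasurable (M.Qopt k) := by
  obtain ⟨W, hW, hfix⟩ := exists_fixedPoint_Tk hR hk
  rwa [Qopt_eq_fixedPoint hR hk hW hfix]

/-- The Bellman optimality equation of the `k`-persistent process. -/
lemma Tk_Qopt (hR : ∀ x, |M.r x| ≤ Rmax) {k : ℕ} (hk : 1 ≤ k) (x : S × A) :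
    M.Tk k (M.Qopt k) x = M.Qopt k x := by
  obtain ⟨W, hW, hfix⟩ := exists_fixedPoint_Tk hR hk
  rw [Qopt_eq_fixedPoint hR hk hW hfix, hfix]

lemma Qπ_le_Qopt (hR : ∀ x, |M.r x| ≤ Rmax) {k : ℕ} (hk : 1 ≤ k) (π : Policy S A) (x : S × A) :
    M.Qπ k π x ≤ M.Qopt k x :=
  Qπ_le_fixedPoint hR hk (bddMeasurable_Qopt hR hk) (Tk_Qopt hR hk) π x

lemma abs_Qopt_le (hR : ∀ x, |M.r x| ≤ Rmax) {k : ℕ} (hk : 1 ≤ k) (x : S × A) :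
    |M.Qopt k x| ≤ Rmax / (1 - M.γ) := by
  obtain ⟨π, hπ⟩ := Policy.exists_isGreedy (bddMeasurable_Qopt hR hk).measurable
  have h : M.Qopt k x = M.Qπ k π x := le_antisymm
    (fixedPoint_le_Qπ hR hk (bddMeasurable_Qopt hR hk) (Tk_Qopt hR hk) hπ x)
    (Qπ_le_Qopt hR hk π x)
  rw [h]
  exact abs_Qπ_le hR k π x

end MDP

lemma ofReal_integral_le_lintegral_ofReal {X : Type*} [MeasurableSpace X] {μ : Measure X}
    {f : X → ℝ} (hf : Integrable f μ) :
    ENNReal.ofReal (∫ x, f x ∂μ) ≤ ∫⁻ x, ENNReal.ofReal (f x) ∂μ := by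
  rw [integral_eq_lintegral_pos_part_sub_lintegral_neg_part hf]
  exact (ENNReal.ofReal_le_ofReal (sub_le_self _ ENNReal.toReal_nonneg)).trans
    ENNReal.ofReal_toReal_le

/-! ### Unrolling recursive inequalities along Markov kernels. -/

section Unrolling

variable {X : Type*} [MeasurableSpace X]

lemma lintegral_lintegral_pow (κ : Kernel X X) (n : ℕ) {f : X → ℝ≥0∞} (hf : Measurable f)
    (x : X) : ∫⁻ y, ∫⁻ z, f z ∂((κ ^ n) y) ∂(κ x) = ∫⁻ z, f z ∂((κ ^ (n + 1)) x) := by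
  rw [pow_succ, ← Kernel.lintegral_comp _ _ _ hf]
  rfl

/-- `backProd κ c n` applies the kernels `κ (c + n), …, κ (c + 1)`, in this order. -/
def backProd (κ : ℕ → Kernel X X) (c : ℕ) : ℕ → Kernel X X
  | 0 => Kernel.id
  | n + 1 => backProd κ c n ∘ₖ κ (c + (n + 1))

instance isMarkovKernel_backProd (κ : ℕ → Kernel X X) [∀ n, IsMarkovKernel (κ n)] (c n : ℕ) :
    IsMarkovKernel (backProd κ c n) := by
  induction n with
  | zero => unfold backProd; infer_instance
  | succ n ih => unfold backProd; infer_instance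

lemma backProd_const (κ : Kernel X X) (c n : ℕ) : backProd (fun _ => κ) c n = κ ^ n := by
  induction n with
  | zero => rfl
  | succ n ih => rw [backProd, ih, pow_succ]; rfl

/-- Unrolling of a linear recursive inequality. -/
lemma le_sum_backProd (κ : ℕ → Kernel X X) [∀ n, IsMarkovKernel (κ n)] (a c₀ : ℝ≥0∞)
    (Y E : ℕ → X → ℝ≥0∞) (D : ℕ) (hE : ∀ d < D, Measurable (E d)) (h0 : ∀ x, Y 0 x ≤ c₀)
    (hY : ∀ d < D, ∀ x, Y (d + 1) x ≤ a * ∫⁻ y, Y d y ∂(κ d x) + E d x) (d : ℕ) (hd : d ≤ D)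
    (x : X) : Y d x ≤ ∑ c ∈ Finset.range d,
      a ^ (d - 1 - c) * ∫⁻ y, E c y ∂(backProd κ c (d - 1 - c) x) + a ^ d * c₀ := by
  induction d generalizing x with
  | zero => simpa using h0 x
  | succ d ih =>
    have hm (c : ℕ) (hc : c ∈ Finset.range d) : Measurable fun y =>
        a ^ (d - 1 - c) * ∫⁻ z, E c z ∂(backProd κ c (d - 1 - c) y) :=
      ((hE c ((Finset.mem_range.1 hc).trans hd)).lintegral_kernel).const_mul _
    calc Y (d + 1) x ≤ a * ∫⁻ y, Y d y ∂(κ d x) + E d x := hY d hd x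
      _ ≤ a * ∫⁻ y, (∑ c ∈ Finset.range d,
            a ^ (d - 1 - c) * ∫⁻ z, E c z ∂(backProd κ c (d - 1 - c) y) + a ^ d * c₀) ∂(κ d x)
            + E d x := by
          gcongr with y
          exact ih (by omega) y
      _ = _ := by
          rw [lintegral_add_right _ measurable_const, lintegral_finsetSum' _
            (fun c hc => (hm c hc).aemeasurable), lintegral_const, measure_univ, mul_one,
            Finset.sum_range_succ, mul_add, Finset.mul_sum, add_right_comm]
          congr 1
          · congr 1
            -- An older error gains one factor `a` and the kernel `κ d`, applied before the others.
            -- The newest error, `c = d`, is seen through the identity kernel.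
            · refine Finset.sum_congr rfl fun c hc => ?_
              have hcd := Finset.mem_range.1 hc
              have hEc := hE c (hcd.trans hd)
              rw [lintegral_const_mul _ hEc.lintegral_kernel, ← mul_assoc, ← pow_succ',
                ← Kernel.lintegral_comp _ _ _ hEc,
                show d + 1 - 1 - c = (d - 1 - c) + 1 by omega, backProd,
                show c + (d - 1 - c + 1) = d by omega]
            · simp [backProd, lintegral_dirac' _ (hE d hd), Kernel.id_apply]
          · rw [← mul_assoc, ← pow_succ']

/-- Infinite unrolling of a discounted recursive inequality for a bounded function. -/
lemma le_tsum_lintegral_pow (κ : Kernel X X) [IsMarkovKernel κ] {a C : ℝ≥0∞} (ha : a < 1)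
    (hC : C ≠ ⊤) {Y H : X → ℝ≥0∞} (hH : Measurable H) (hYC : ∀ x, Y x ≤ C)
    (hY : ∀ x, Y x ≤ a * ∫⁻ y, Y y ∂(κ x) + H x) (x : X) :
    Y x ≤ ∑' m : ℕ, a ^ m * ∫⁻ y, H y ∂((κ ^ m) x) := by
  have hn (n : ℕ) : Y x ≤ ∑' m : ℕ, a ^ m * ∫⁻ y, H y ∂((κ ^ m) x) + a ^ n * C := by
    have := le_sum_backProd (fun _ => κ) a C (fun _ => Y) (fun _ => H) n (fun _ _ => hH) hYC
      (fun _ _ => hY) n le_rfl x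
    refine this.trans (add_le_add_left ?_ _)
    simp only [backProd_const]
    -- Unrolling indexes the terms by birth time, the series by age.
    rw [Finset.sum_range_reflect (fun m => a ^ m * ∫⁻ y, H y ∂((κ ^ m) x)) n]
    exact ENNReal.sum_le_tsum _
  have hlim : Filter.Tendsto (fun n : ℕ => ∑' m : ℕ, a ^ m * ∫⁻ y, H y ∂((κ ^ m) x) + a ^ n * C)
      Filter.atTop (nhds (∑' m : ℕ, a ^ m * ∫⁻ y, H y ∂((κ ^ m) x))) := by
    have h1 := ENNReal.Tendsto.mul_const (ENNReal.tendsto_pow_atTop_nhds_zero_of_lt_one ha)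
      (b := C) (Or.inr hC)
    rw [zero_mul] at h1
    simpa using h1.const_add (∑' m : ℕ, a ^ m * ∫⁻ y, H y ∂((κ ^ m) x))
  exact ge_of_tendsto' hlim hn

end Unrolling

/-! ### Error propagation over one period of `k` iterates. -/

namespace MDP

variable {S A : Type*} [MeasurableSpace S] [MeasurableSpace A] {M : MDP S A} {Rmax : ℝ}

lemma chain_eq_bind (k c : ℕ) (π : ℕ → Policy S A) (n : ℕ) (μ : Measure (S × A)) :
    M.chain k (fun l => π (k * (c + l))) n μ =
      μ.bind (backProd (fun d => M.Pkπ k (π (k * d))) c n) := by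
  induction n generalizing μ with
  | zero => exact (Measure.bind_dirac (m := μ)).symm
  | succ n ih => rw [chain, ih, backProd, Measure.comp_assoc]

/-- False in general at `n = 0`: truncated subtraction makes `Pk 0` equal to `Pk 1 = P`. -/
lemma Pk_succ {n : ℕ} (hn : 1 ≤ n) : M.Pk (n + 1) = M.Pk n ∘ₖ M.Pδ := by
  obtain ⟨n, rfl⟩ : ∃ m, n = m + 1 := ⟨n - 1, by omega⟩
  rw [Pk, Pk, Nat.add_sub_cancel, Nat.add_sub_cancel, pow_succ, Kernel.comp_assoc]
  rfl

lemma Tk_one (hR : ∀ x, |M.r x| ≤ Rmax) (f : S × A → ℝ) (x : S × A) :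
    M.Tk 1 f x = M.Topt f x := by
  have h1 : M.Pk 1 = M.P := Kernel.comp_id _
  have h2 : ∫ y, M.r y ∂((M.Pδ ^ 0) x) = M.r x :=
    integral_dirac' _ _ (M.bddMeasurable_r hR).measurable.stronglyMeasurable
  rw [Tk, Topt, rk, Finset.sum_range_one, h1, h2, pow_zero, pow_one, one_mul]

lemma integral_pow_succ (n : ℕ) {f : S × A → ℝ} (hf : BddMeasurable f) (x : S × A) :
    ∫ y, ∫ z, f z ∂((M.Pδ ^ n) y) ∂(M.Pδ x) = ∫ z, f z ∂((M.Pδ ^ (n + 1)) x) := by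
  have h := Kernel.integral_comp (η := M.Pδ ^ n) (κ := M.Pδ) (a := x) (hf.integrable _)
  rw [← h, pow_succ]
  rfl

lemma bddMeasurable_Tδ (hR : ∀ x, |M.r x| ≤ Rmax) {f : S × A → ℝ} (hf : BddMeasurable f) :
    BddMeasurable (M.Tδ f) :=
  (M.bddMeasurable_r hR).add ((hf.integral_kernel _).const_mul _)

lemma enorm_Tδ_sub_le {f h : S × A → ℝ} (hf : BddMeasurable f) (hh : BddMeasurable h)
    (x : S × A) :
    ‖M.Tδ f x - M.Tδ h x‖ₑ ≤ ENNReal.ofReal M.γ * ∫⁻ y, ‖f y - h y‖ₑ ∂(M.Pδ x) := by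
  have : M.Tδ f x - M.Tδ h x = M.γ * ∫ y, (f y - h y) ∂(M.Pδ x) := by
    rw [integral_sub (hf.integrable _) (hh.integrable _)]
    unfold Tδ
    ring
  rw [this, enorm_mul, Real.enorm_of_nonneg M.γ_nonneg]
  gcongr
  exact enorm_integral_le_lintegral_enorm _

/-- The error accumulated along a period of `k` iterates. -/
def periodErr (M : MDP S A) (k : ℕ) (Q : ℕ → S × A → ℝ) (d : ℕ) (x : S × A) : ℝ≥0∞ :=
  ∑ l ∈ Finset.range k, ENNReal.ofReal M.γ ^ (k - 1 - l) *
    ∫⁻ y, ‖M.err k Q (k * d + l) y‖ₑ ∂((M.Pδ ^ (k - 1 - l)) x)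

lemma measurable_periodErr (k : ℕ) {Q : ℕ → S × A → ℝ} (d : ℕ)
    (hε : ∀ l < k, Measurable (M.err k Q (k * d + l))) : Measurable (M.periodErr k Q d) :=
  Finset.measurable_sum _ fun l hl =>
    ((hε l (Finset.mem_range.1 hl)).enorm.lintegral_kernel).const_mul _

variable [Finite A] [Nonempty A]

/-- Prepending one repeated step to an `n`-step block lengthens the block by one. Iterated from `Tk
1 = T^*`, this identifies `Tk k` with `k - 1` applications of `T^δ` after `T^*`. -/
lemma Tδ_Tk (hR : ∀ x, |M.r x| ≤ Rmax) {n : ℕ} (hn : 1 ≤ n) {f : S × A → ℝ}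
    (hf : BddMeasurable f) (x : S × A) : M.Tδ (M.Tk n f) x = M.Tk (n + 1) f x := by
  have hr := M.bddMeasurable_r hR
  have h2 : ∫ y, M.r y ∂((M.Pδ ^ 0) x) = M.r x :=
    integral_dirac' _ _ hr.measurable.stronglyMeasurable
  have h3 : ∫ y, M.rk n y ∂(M.Pδ x) =
      ∑ t ∈ Finset.range n, M.γ ^ t * ∫ y, M.r y ∂((M.Pδ ^ (t + 1)) x) := by
    unfold rk
    rw [integral_finsetSum _ fun t _ => ((hr.integral_kernel (M.Pδ ^ t)).const_mul
      (M.γ ^ t)).integrable (M.Pδ x)]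
    refine Finset.sum_congr rfl fun t _ => ?_
    rw [integral_const_mul, integral_pow_succ t hr]
  unfold Tδ
  simp only [Tk]
  rw [integral_add ((bddMeasurable_rk hR n).integrable _)
    (((hf.iSup_snd.integral_kernel _).const_mul _).integrable _), integral_const_mul, h3,
    Pk_succ hn, Kernel.integral_comp (hf.iSup_snd.integrable _), rk, Finset.sum_range_succ', h2,
    mul_add, Finset.mul_sum, pow_succ']
  simp only [pow_succ']
  ring_nf

lemma bddMeasurable_err (hR : ∀ x, |M.r x| ≤ Rmax) (k : ℕ) {Q : ℕ → S × A → ℝ} {j : ℕ}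
    (hj : BddMeasurable (Q j)) (hj' : BddMeasurable (Q (j + 1))) :
    BddMeasurable (M.err k Q j) := by
  unfold err
  split_ifs
  · have : BddMeasurable (M.Topt (Q j)) :=
      (M.bddMeasurable_r hR).add ((hj.iSup_snd.integral_kernel _).const_mul _)
    exact this.sub hj'
  · exact (bddMeasurable_Tδ hR hj).sub hj'

/-- Inside a period the exact and the computed iterates both move by `T^δ`, the latter up to `ε`. As
`T^δ` is affine and involves no maximization, the gap can be tracked in absolute value along `P^δ`
alone. -/
lemma enorm_Tk_sub_le (hR : ∀ x, |M.r x| ≤ Rmax) {k : ℕ} {Q : ℕ → S × A → ℝ} {d : ℕ}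
    (hQ : ∀ j ≤ k * (d + 1), BddMeasurable (Q j)) (i : ℕ) (hi : i < k) (x : S × A) :
    ‖M.Tk (i + 1) (Q (k * d)) x - Q (k * d + (i + 1)) x‖ₑ ≤
      ∑ l ∈ Finset.range (i + 1), ENNReal.ofReal M.γ ^ (i - l) *
        ∫⁻ y, ‖M.err k Q (k * d + l) y‖ₑ ∂((M.Pδ ^ (i - l)) x) := by
  have hQ' (i : ℕ) (hi : i ≤ k) : BddMeasurable (Q (k * d + i)) :=
    hQ _ (by rw [mul_add, mul_one]; omega)
  have hε (l : ℕ) (hl : l < k) : BddMeasurable (M.err k Q (k * d + l)) :=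
    bddMeasurable_err hR k (hQ' l hl.le) (hQ' (l + 1) hl)
  have hid {f : S × A → ℝ≥0∞} (hf : Measurable f) (x : S × A) :
      ∫⁻ y, f y ∂((M.Pδ ^ 0) x) = f x := lintegral_dirac' _ hf
  induction i generalizing x with
  | zero =>
    have h1 : M.err k Q (k * d) x = M.Topt (Q (k * d)) x - Q (k * d + 1) x := by
      simp [err]
    have h2 := hid (hε 0 hi).measurable.enorm x
    rw [zero_add, Finset.sum_range_one, h2, Tk_one hR, pow_zero, one_mul, add_zero, h1]
  | succ i ih =>
    have hQ0 : BddMeasurable (Q (k * d)) := hQ' 0 (Nat.zero_le k)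
    have hT : BddMeasurable (M.Tk (i + 1) (Q (k * d))) := bddMeasurable_Tk hR _ hQ0
    have h1 : M.Tk (i + 1 + 1) (Q (k * d)) x - Q (k * d + (i + 1 + 1)) x =
        (M.Tδ (M.Tk (i + 1) (Q (k * d))) x - M.Tδ (Q (k * d + (i + 1))) x) +
          M.err k Q (k * d + (i + 1)) x := by
      have h0 : (k * d + (i + 1)) % k ≠ 0 := by
        rw [Nat.mul_add_mod, Nat.mod_eq_of_lt hi]; omega
      rw [Tδ_Tk hR (Nat.le_add_left 1 i) hQ0, err, if_neg h0]
      ring_nf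
    rw [h1, Finset.sum_range_succ, Nat.sub_self, pow_zero, one_mul,
      hid (hε _ hi).measurable.enorm x]
    refine (enorm_add_le _ _).trans (add_le_add_left ?_ _)
    refine (enorm_Tδ_sub_le hT (hQ' (i + 1) hi.le) x).trans ?_
    calc _ ≤ ENNReal.ofReal M.γ * ∫⁻ y, (∑ l ∈ Finset.range (i + 1),
          ENNReal.ofReal M.γ ^ (i - l) * ∫⁻ z, ‖M.err k Q (k * d + l) z‖ₑ
            ∂((M.Pδ ^ (i - l)) y)) ∂(M.Pδ x) := by
          gcongr with y
          exact ih (by omega) y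
      _ = _ := by
        rw [lintegral_finsetSum' _ fun l hl => ((((hε l (by
          have := Finset.mem_range.1 hl; omega)).measurable.enorm.lintegral_kernel).const_mul
            _).aemeasurable), Finset.mul_sum]
        refine Finset.sum_congr rfl fun l hl => ?_
        have hl' := Finset.mem_range.1 hl
        have hm := (hε l (by omega)).measurable.enorm
        rw [lintegral_const_mul _ hm.lintegral_kernel, ← mul_assoc, ← pow_succ',
          lintegral_lintegral_pow _ _ hm, show i + 1 - l = i - l + 1 by omega]

lemma enorm_Tk_sub_le_periodErr (hR : ∀ x, |M.r x| ≤ Rmax) {k : ℕ} (hk : 1 ≤ k)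
    {Q : ℕ → S × A → ℝ} {d : ℕ} (hQ : ∀ j ≤ k * (d + 1), BddMeasurable (Q j)) (x : S × A) :
    ‖M.Tk k (Q (k * d)) x - Q (k * (d + 1)) x‖ₑ ≤ M.periodErr k Q d x := by
  have := enorm_Tk_sub_le hR hQ (k - 1) (by omega) x
  rwa [Nat.sub_add_cancel hk] at this

variable [MeasurableSingletonClass A]

/-- Greediness for the minuend `f` attains its maximum, while for `h` the same policy only gives a
lower bound. The transporting policy thus depends on the sign considered, which forces one-sided
estimates. -/
lemma Tk_sub_le_of_isGreedy (k : ℕ) {f h : S × A → ℝ} (hf : BddMeasurable f)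
    (hh : BddMeasurable h) {π : Policy S A} (hπ : π.IsGreedy f) (x : S × A) :
    M.Tk k f x - M.Tk k h x ≤ M.γ ^ k * ∫ y, (f y - h y) ∂(M.Pkπ k π x) := by
  rw [integral_sub (hf.integrable _) (hh.integrable _), integral_Pkπ_of_isGreedy k hf hπ, Tk, Tk]
  have := mul_le_mul_of_nonneg_left (integral_Pkπ_le (M := M) k π hh x) (pow_nonneg M.γ_nonneg k)
  linarith

lemma ofReal_Tk_sub_le (k : ℕ) {f h : S × A → ℝ} (hf : BddMeasurable f)
    (hh : BddMeasurable h) {π : Policy S A} (hπ : π.IsGreedy f) (x : S × A) :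
    ENNReal.ofReal (M.Tk k f x - M.Tk k h x) ≤
      ENNReal.ofReal M.γ ^ k * ∫⁻ y, ENNReal.ofReal (f y - h y) ∂(M.Pkπ k π x) := by
  refine (ENNReal.ofReal_le_ofReal (Tk_sub_le_of_isGreedy k hf hh hπ x)).trans ?_
  rw [ENNReal.ofReal_mul (pow_nonneg M.γ_nonneg k), ENNReal.ofReal_pow M.γ_nonneg]
  gcongr
  exact ofReal_integral_le_lintegral_ofReal ((hf.sub hh).integrable _)

/-- `ENNReal.ofReal` acts as the positive part. The minuend is `Qopt`, so the transport is along
`π*`. -/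
lemma ofReal_Qopt_sub_le (hR : ∀ x, |M.r x| ≤ Rmax) {k : ℕ} (hk : 1 ≤ k)
    {πstar : Policy S A} (hπstar : πstar.IsGreedy (M.Qopt k))
    {Q : ℕ → S × A → ℝ} {d : ℕ} (hQ : ∀ j ≤ k * (d + 1), BddMeasurable (Q j)) (x : S × A) :
    ENNReal.ofReal (M.Qopt k x - Q (k * (d + 1)) x) ≤
      ENNReal.ofReal M.γ ^ k *
        ∫⁻ y, ENNReal.ofReal (M.Qopt k y - Q (k * d) y) ∂(M.Pkπ k πstar x) +
      M.periodErr k Q d x := by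
  have hQd : BddMeasurable (Q (k * d)) := hQ _ (Nat.mul_le_mul_left _ (by omega))
  calc ENNReal.ofReal (M.Qopt k x - Q (k * (d + 1)) x)
      = ENNReal.ofReal ((M.Tk k (M.Qopt k) x - M.Tk k (Q (k * d)) x) +
          (M.Tk k (Q (k * d)) x - Q (k * (d + 1)) x)) := by rw [Tk_Qopt hR hk]; ring_nf
    _ ≤ _ := ENNReal.ofReal_add_le
    _ ≤ _ := add_le_add (ofReal_Tk_sub_le k (bddMeasurable_Qopt hR hk) hQd hπstar x)
        ((Real.ofReal_le_enorm _).trans (enorm_Tk_sub_le_periodErr hR hk hQ x))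

/-- In the opposite direction the minuend is the iterate, so its own greedy policy transports the
gap. -/
lemma ofReal_sub_Qopt_le (hR : ∀ x, |M.r x| ≤ Rmax) {k : ℕ} (hk : 1 ≤ k)
    {Q : ℕ → S × A → ℝ} {d : ℕ} (hQ : ∀ j ≤ k * (d + 1), BddMeasurable (Q j))
    {π : Policy S A} (hπ : π.IsGreedy (Q (k * d))) (x : S × A) :
    ENNReal.ofReal (Q (k * (d + 1)) x - M.Qopt k x) ≤
      ENNReal.ofReal M.γ ^ k *
        ∫⁻ y, ENNReal.ofReal (Q (k * d) y - M.Qopt k y) ∂(M.Pkπ k π x) +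
      M.periodErr k Q d x := by
  have hQd : BddMeasurable (Q (k * d)) := hQ _ (Nat.mul_le_mul_left _ (by omega))
  calc ENNReal.ofReal (Q (k * (d + 1)) x - M.Qopt k x)
      = ENNReal.ofReal ((M.Tk k (Q (k * d)) x - M.Tk k (M.Qopt k) x) +
          (-(M.Tk k (Q (k * d)) x - Q (k * (d + 1)) x))) := by rw [Tk_Qopt hR hk]; ring_nf
    _ ≤ _ := ENNReal.ofReal_add_le
    _ ≤ _ := add_le_add (ofReal_Tk_sub_le k hQd (bddMeasurable_Qopt hR hk) hπ x)
        ((Real.ofReal_le_enorm _).trans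
          (by rw [enorm_neg]; exact enorm_Tk_sub_le_periodErr hR hk hQ x))

/-- Write the loss as `γ^k (P^{π*} Qopt - P^π Qπ)`, insert `Qopt` under `P^π`, and use `P^{π*} f ≤
P^π f`, the greediness of `π` for `f`. -/
lemma ofReal_Qopt_sub_Qπ_le (hR : ∀ x, |M.r x| ≤ Rmax) {k : ℕ} (hk : 1 ≤ k)
    {πstar : Policy S A} (hπstar : πstar.IsGreedy (M.Qopt k)) {f : S × A → ℝ}
    (hf : BddMeasurable f) {π : Policy S A} (hπ : π.IsGreedy f) (x : S × A) :
    ENNReal.ofReal (M.Qopt k x - M.Qπ k π x) ≤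
      ENNReal.ofReal M.γ ^ k * ∫⁻ y, ENNReal.ofReal (M.Qopt k y - M.Qπ k π y) ∂(M.Pkπ k π x) +
      ENNReal.ofReal M.γ ^ k * (∫⁻ y, ENNReal.ofReal (M.Qopt k y - f y) ∂(M.Pkπ k πstar x) +
        ∫⁻ y, ENNReal.ofReal (f y - M.Qopt k y) ∂(M.Pkπ k π x)) := by
  have hO := bddMeasurable_Qopt hR hk
  have hQ := bddMeasurable_Qπ hR k π
  have h1 : M.Qopt k x - M.Qπ k π x ≤ M.γ ^ k * (∫ y, (M.Qopt k y - M.Qπ k π y) ∂(M.Pkπ k π x) +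
      (∫ y, (M.Qopt k y - f y) ∂(M.Pkπ k πstar x) +
        ∫ y, (f y - M.Qopt k y) ∂(M.Pkπ k π x))) := by
    have h2 : M.Qopt k x - M.Qπ k π x = M.γ ^ k *
        (∫ y, M.Qopt k y ∂(M.Pkπ k πstar x) - ∫ y, M.Qπ k π y ∂(M.Pkπ k π x)) := by
      rw [Qπ_eq hR hk, ← Tk_Qopt hR hk, Tk, ← integral_Pkπ_of_isGreedy k hO hπstar]
      ring
    have h3 : ∫ y, f y ∂(M.Pkπ k πstar x) ≤ ∫ y, f y ∂(M.Pkπ k π x) := by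
      rw [integral_Pkπ_of_isGreedy k hf hπ]
      exact integral_Pkπ_le k πstar hf x
    rw [h2, integral_sub (hO.integrable _) (hQ.integrable _),
      integral_sub (hO.integrable _) (hf.integrable _),
      integral_sub (hf.integrable _) (hO.integrable _)]
    refine mul_le_mul_of_nonneg_left ?_ (pow_nonneg M.γ_nonneg k)
    linarith
  refine (ENNReal.ofReal_le_ofReal h1).trans ?_
  rw [ENNReal.ofReal_mul (pow_nonneg M.γ_nonneg k), ENNReal.ofReal_pow M.γ_nonneg, ← mul_add]
  gcongr
  refine ENNReal.ofReal_add_le.trans (add_le_add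
    (ofReal_integral_le_lintegral_ofReal ((hO.sub hQ).integrable _)) ?_)
  exact ENNReal.ofReal_add_le.trans (add_le_add
    (ofReal_integral_le_lintegral_ofReal ((hO.sub hf).integrable _))
    (ofReal_integral_le_lintegral_ofReal ((hf.sub hO).integrable _)))

end MDP

/-! ### The pointwise bound over all iterates. -/

lemma sum_range_mul {N : Type*} [AddCommMonoid N] (F : ℕ → N) (k D : ℕ) :
    ∑ j ∈ Finset.range (k * D), F j =
      ∑ c ∈ Finset.range D, ∑ l ∈ Finset.range k, F (k * c + l) := by
  induction D with
  | zero => simp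
  | succ D ih => rw [mul_add, mul_one, Finset.sum_range_add, ih, Finset.sum_range_succ]

namespace MDP

variable {S A : Type*} [MeasurableSpace S] [MeasurableSpace A] {M : MDP S A} {Rmax : ℝ}

/-- Integrated form of the unrolled error recursion, indexed by the single iterates. -/
lemma lintegral_le_sum_err {k : ℕ} (hk : 1 ≤ k) (D : ℕ) {Q : ℕ → S × A → ℝ}
    (hε : ∀ j < k * D, Measurable (M.err k Q j))
    (κ : ℕ → Kernel (S × A) (S × A)) [∀ n, IsMarkovKernel (κ n)]
    (κ' : Kernel (S × A) (S × A)) [IsMarkovKernel κ'] {Y : ℕ → S × A → ℝ≥0∞} {c₀ : ℝ≥0∞}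
    (h0 : ∀ x, Y 0 x ≤ c₀)
    (hY : ∀ d < D, ∀ x, Y (d + 1) x ≤
      ENNReal.ofReal M.γ ^ k * ∫⁻ y, Y d y ∂(κ d x) + M.periodErr k Q d x) (x : S × A) :
    ∫⁻ y, Y D y ∂(κ' x) ≤ ∑ j ∈ Finset.range (k * D), ENNReal.ofReal M.γ ^ (k * D - j - 1) *
      ∫⁻ z, ‖M.err k Q j z‖ₑ
        ∂((((M.Pδ ^ (k - j % k - 1)) ∘ₖ backProd κ (j / k) (D - j / k - 1)) ∘ₖ κ') x) +
      ENNReal.ofReal M.γ ^ (k * D) * c₀ := by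
  set g := ENNReal.ofReal M.γ
  have hlt {c l : ℕ} (hc : c < D) (hl : l < k) : k * c + l < k * D :=
    calc k * c + l < k * c + k := by omega
      _ = k * (c + 1) := by ring
      _ ≤ k * D := Nat.mul_le_mul_left k hc
  have hE (d : ℕ) (hd : d < D) : Measurable (M.periodErr k Q d) :=
    measurable_periodErr k d fun l hl => hε _ (hlt hd hl)
  calc ∫⁻ y, Y D y ∂(κ' x)
      ≤ ∫⁻ y, (∑ c ∈ Finset.range D, (g ^ k) ^ (D - 1 - c) *
          ∫⁻ z, M.periodErr k Q c z ∂(backProd κ c (D - 1 - c) y) + (g ^ k) ^ D * c₀) ∂(κ' x) :=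
        lintegral_mono fun y => le_sum_backProd κ (g ^ k) c₀ Y (M.periodErr k Q) D hE h0 hY D
          le_rfl y
    _ = ∑ c ∈ Finset.range D, (g ^ k) ^ (D - 1 - c) *
          ∫⁻ z, M.periodErr k Q c z ∂((backProd κ c (D - 1 - c) ∘ₖ κ') x) + g ^ (k * D) * c₀ := by
        rw [lintegral_add_right _ measurable_const, lintegral_finsetSum' _ fun c hc =>
          (((hE c (Finset.mem_range.1 hc)).lintegral_kernel).const_mul _).aemeasurable,
          lintegral_const, measure_univ, mul_one, ← pow_mul]
        congr 1
        refine Finset.sum_congr rfl fun c hc => ?_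
        have hEc := hE c (Finset.mem_range.1 hc)
        rw [lintegral_const_mul _ hEc.lintegral_kernel, Kernel.lintegral_comp _ _ _ hEc]
    _ = _ := by
        rw [sum_range_mul]
        congr 1
        refine Finset.sum_congr rfl fun c hc => ?_
        have hc' := Finset.mem_range.1 hc
        unfold periodErr
        rw [lintegral_finsetSum' _ fun l hl => (((hε _ (hlt hc'
          (Finset.mem_range.1 hl))).enorm.lintegral_kernel).const_mul _).aemeasurable,
          Finset.mul_sum]
        refine Finset.sum_congr rfl fun l hl => ?_
        have hl' := Finset.mem_range.1 hl
        have hm := (hε _ (hlt hc' hl')).enorm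
        have hdiv : (k * c + l) / k = c := by
          rw [Nat.mul_add_div (by omega), Nat.div_eq_of_lt hl', add_zero]
        have hmod : (k * c + l) % k = l := by rw [Nat.mul_add_mod, Nat.mod_eq_of_lt hl']
        -- The discount after step `l` of period `c` splits into the later full periods and the rest
        -- of that period.
        have hexp : k * D - (k * c + l) - 1 = k * (D - 1 - c) + (k - 1 - l) := by
          obtain ⟨e, rfl⟩ : ∃ e, D = c + 1 + e := ⟨D - (c + 1), by omega⟩
          rw [show c + 1 + e - 1 - c = e by omega, mul_add, mul_add, mul_one]
          omega
        rw [hdiv, hmod, lintegral_const_mul _ hm.lintegral_kernel, ← mul_assoc, ← pow_mul,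
          ← pow_add, hexp, Kernel.comp_assoc, Kernel.lintegral_comp _ _ _ hm,
          show D - c - 1 = D - 1 - c by omega, show k - l - 1 = k - 1 - l by omega]

/-- The kernel through which the error of an iterate acts along the optimal policy. -/
def errKernel₁ (M : MDP S A) (k : ℕ) (πstar : Policy S A) (m₁ m₂ m₃ : ℕ) (π : Policy S A) :
    Kernel (S × A) (S × A) :=
  ((M.Pδ ^ m₃) ∘ₖ (M.Pkπ k πstar ^ m₂)) ∘ₖ (M.Pkπ k π ^ m₁)

/-- The kernel through which the error of an iterate acts along the policies
`π (k (c + 1)), …, π (k (c + L))`. -/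
def errKernel₂ (M : MDP S A) (k m₁ m₂ c L : ℕ) (π : ℕ → Policy S A) : Kernel (S × A) (S × A) :=
  ((M.Pδ ^ m₂) ∘ₖ backProd (fun d => M.Pkπ k (π (k * d))) c (L - 1)) ∘ₖ
    (M.Pkπ k (π (k * (c + L))) ^ m₁)

instance (k : ℕ) (πstar : Policy S A) (m₁ m₂ m₃ : ℕ) (π : Policy S A) :
    IsMarkovKernel (M.errKernel₁ k πstar m₁ m₂ m₃ π) := by unfold errKernel₁; infer_instance

instance (k m₁ m₂ c L : ℕ) (π : ℕ → Policy S A) :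
    IsMarkovKernel (M.errKernel₂ k m₁ m₂ c L π) := by unfold errKernel₂; infer_instance

lemma cVI₁_eq (k : ℕ) (q : ℝ≥0∞) (ρ ν : Measure (S × A)) (πstar : Policy S A)
    (m₁ m₂ m₃ : ℕ) (π : Policy S A) :
    M.cVI₁ k q ρ ν πstar m₁ m₂ m₃ π =
      densityNorm q (ρ.bind (M.errKernel₁ k πstar m₁ m₂ m₃ π)) ν := by
  rw [cVI₁, errKernel₁, Measure.comp_assoc, Measure.comp_assoc, Kernel.comp_assoc]

lemma cVI₂_eq (k : ℕ) (q : ℝ≥0∞) (ρ ν : Measure (S × A)) (m₁ m₂ c L : ℕ)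
    (π : ℕ → Policy S A) :
    M.cVI₂ k q ρ ν m₁ m₂ L (fun l => π (k * (c + l))) =
      densityNorm q (ρ.bind (M.errKernel₂ k m₁ m₂ c L π)) ν := by
  rw [cVI₂, errKernel₂, chain_eq_bind, Measure.comp_assoc, Measure.comp_assoc, Kernel.comp_assoc]

variable [Finite A] [Nonempty A] [MeasurableSingletonClass A]

/-- Pointwise error propagation bound. -/
theorem ofReal_Qopt_sub_Qπ_le_tsum (hR : ∀ x, |M.r x| ≤ Rmax) {k : ℕ} (hk : 1 ≤ k) (D : ℕ)
    {πstar : Policy S A} (hπstar : πstar.IsGreedy (M.Qopt k)) {Q : ℕ → S × A → ℝ}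
    (hQ : ∀ j ≤ k * D, BddMeasurable (Q j)) {π : ℕ → Policy S A}
    (hπ : ∀ d ≤ D, (π (k * d)).IsGreedy (Q (k * d))) {c₀ : ℝ}
    (hc₀ : ∀ x, |M.Qopt k x - Q 0 x| ≤ c₀) (x : S × A) :
    ENNReal.ofReal (M.Qopt k x - M.Qπ k (π (k * D)) x) ≤
      ENNReal.ofReal M.γ ^ k * ∑' m : ℕ, ENNReal.ofReal M.γ ^ (k * m) *
        (∑ j ∈ Finset.range (k * D), ENNReal.ofReal M.γ ^ (k * D - j - 1) *
          (∫⁻ z, ‖M.err k Q j z‖ₑ ∂(M.errKernel₁ k πstar m (D - j / k) (k - j % k - 1)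
              (π (k * D)) x) +
            ∫⁻ z, ‖M.err k Q j z‖ₑ ∂(M.errKernel₂ k (m + 1) (k - j % k - 1) (j / k) (D - j / k)
              π x)) +
          2 * (ENNReal.ofReal M.γ ^ (k * D) * ENNReal.ofReal c₀)) := by
  set g := ENNReal.ofReal M.γ with hg
  have hg1 : g ^ k < 1 := by
    rw [hg, ← ENNReal.ofReal_pow M.γ_nonneg, ENNReal.ofReal_lt_one]
    exact γ_pow_lt_one hk
  have hε (j : ℕ) (hj : j < k * D) : Measurable (M.err k Q j) :=
    (bddMeasurable_err hR k (hQ j hj.le) (hQ (j + 1) hj)).measurable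
  have hdiv {j : ℕ} (hj : j ∈ Finset.range (k * D)) : j / k < D :=
    Nat.div_lt_of_lt_mul (Finset.mem_range.1 hj)
  have hQd {d : ℕ} (hd : d < D) (j : ℕ) (hj : j ≤ k * (d + 1)) : BddMeasurable (Q j) :=
    hQ j (hj.trans (Nat.mul_le_mul_left k hd))
  have hO := bddMeasurable_Qopt (M := M) hR hk
  have hU (y : S × A) := lintegral_le_sum_err hk D hε (fun _ => M.Pkπ k πstar) (M.Pkπ k πstar)
    (Y := fun d x => ENNReal.ofReal (M.Qopt k x - Q (k * d) x)) (c₀ := ENNReal.ofReal c₀)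
    (fun x => ENNReal.ofReal_le_ofReal ((le_abs_self _).trans (hc₀ x)))
    (fun d hd x => ofReal_Qopt_sub_le hR hk hπstar (hQd hd) x) y
  have hV (y : S × A) := lintegral_le_sum_err hk D hε (fun d => M.Pkπ k (π (k * d)))
    (M.Pkπ k (π (k * D)))
    (Y := fun d x => ENNReal.ofReal (Q (k * d) x - M.Qopt k x)) (c₀ := ENNReal.ofReal c₀)
    (fun x => ENNReal.ofReal_le_ofReal ((le_abs_self _).trans (by
      rw [abs_sub_comm]; exact hc₀ x)))
    (fun d hd x => ofReal_sub_Qopt_le hR hk (hQd hd) (hπ d hd.le) x) y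
  have hH : Measurable fun y =>
      g ^ k * (∫⁻ z, ENNReal.ofReal (M.Qopt k z - Q (k * D) z) ∂(M.Pkπ k πstar y) +
        ∫⁻ z, ENNReal.ofReal (Q (k * D) z - M.Qopt k z) ∂(M.Pkπ k (π (k * D)) y)) := by
    have h1 := (hO.sub (hQ (k * D) le_rfl)).measurable.ennreal_ofReal
    have h2 := ((hQ (k * D) le_rfl).sub hO).measurable.ennreal_ofReal
    exact (h1.lintegral_kernel.add h2.lintegral_kernel).const_mul _
  obtain ⟨C, hC⟩ := (hO.sub (bddMeasurable_Qπ hR k (π (k * D)))).bdd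
  refine (le_tsum_lintegral_pow (M.Pkπ k (π (k * D))) hg1 (C := ENNReal.ofReal C)
    ENNReal.ofReal_ne_top hH (fun y => ENNReal.ofReal_le_ofReal ((le_abs_self _).trans (hC y)))
    (fun y => ofReal_Qopt_sub_Qπ_le hR hk hπstar (hQ _ le_rfl) (hπ D le_rfl) y) x).trans ?_
  rw [← ENNReal.tsum_mul_left]
  refine ENNReal.tsum_le_tsum fun m => ?_
  rw [← pow_mul, mul_left_comm]
  refine mul_le_mul_right ?_ _
  have hm1 (j : ℕ) (hj : j ∈ Finset.range (k * D)) := (hε j (Finset.mem_range.1 hj)).enorm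
  calc _ ≤ ∫⁻ y, g ^ k * (∑ j ∈ Finset.range (k * D), g ^ (k * D - j - 1) *
        (∫⁻ z, ‖M.err k Q j z‖ₑ
          ∂(((M.Pδ ^ (k - j % k - 1)) ∘ₖ (M.Pkπ k πstar ^ (D - j / k))) y) +
        ∫⁻ z, ‖M.err k Q j z‖ₑ ∂((((M.Pδ ^ (k - j % k - 1)) ∘ₖ
          backProd (fun d => M.Pkπ k (π (k * d))) (j / k) (D - j / k - 1)) ∘ₖ
          M.Pkπ k (π (k * D))) y)) + 2 * (g ^ (k * D) * ENNReal.ofReal c₀))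
          ∂((M.Pkπ k (π (k * D)) ^ m) x) := by
        refine lintegral_mono fun y => mul_le_mul_right ((add_le_add (hU y) (hV y)).trans
          (le_of_eq ?_)) _
        rw [add_add_add_comm, ← two_mul, ← Finset.sum_add_distrib]
        congr 1
        refine Finset.sum_congr rfl fun j hj => ?_
        rw [mul_add, backProd_const, Kernel.comp_assoc]
        have := hdiv hj
        congr 5
        -- The kernel `P_k^{π*}` from the loss recursion supplies the last factor of the power `D -
        -- j / k`.
        rw [show D - j / k = D - j / k - 1 + 1 by omega, pow_succ, Nat.add_sub_cancel]
        rfl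
    _ = _ := by
        have hmm (j : ℕ) (hj : j ∈ Finset.range (k * D)) := ((hm1 j hj).lintegral_kernel
          (κ := (M.Pδ ^ (k - j % k - 1)) ∘ₖ (M.Pkπ k πstar ^ (D - j / k)))).add
          ((hm1 j hj).lintegral_kernel (κ := (((M.Pδ ^ (k - j % k - 1)) ∘ₖ
          backProd (fun d => M.Pkπ k (π (k * d))) (j / k) (D - j / k - 1)) ∘ₖ
          M.Pkπ k (π (k * D)))))
        simp only [Pi.add_def] at hmm
        rw [lintegral_const_mul _ (by
            refine Measurable.add (Finset.measurable_sum _ fun j hj => ?_) measurable_const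
            exact (hmm j hj).const_mul _),
          lintegral_add_right _ measurable_const, lintegral_const, measure_univ, mul_one,
          lintegral_finsetSum' _ fun j hj => ((hmm j hj).const_mul _).aemeasurable]
        congr 2
        refine Finset.sum_congr rfl fun j hj => ?_
        have hd := hdiv hj
        -- In the second family the extra `P_k^{π_J}` joins the `m`-th power, whence the exponent `m
        -- + 1`.
        rw [lintegral_const_mul _ (hmm j hj), lintegral_add_left (hm1 j hj).lintegral_kernel,
          ← Kernel.lintegral_comp _ _ _ (hm1 j hj), ← Kernel.lintegral_comp _ _ _ (hm1 j hj),
          errKernel₁, errKernel₂, show j / k + (D - j / k) = D by omega, pow_succ',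
          Kernel.comp_assoc _ (M.Pkπ k (π (k * D)))]
        rfl

end MDP

/-! ### Jensen, Hölder and Cauchy–Schwarz inequalities. -/

/-- Jensen's inequality for countable sums. -/
lemma ENNReal.tsum_weight_mul_le {ι : Type*} {p : ℝ} (hp : 1 ≤ p) (w f : ι → ℝ≥0∞) :
    ∑' i, w i * f i ≤ (∑' i, w i) ^ (1 - p⁻¹) * (∑' i, w i * f i ^ p) ^ p⁻¹ := by
  rw [ENNReal.tsum_eq_iSup_sum]
  refine iSup_le fun s => ?_
  have hp' : 0 ≤ p⁻¹ := by positivity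
  have hp'' : 0 ≤ 1 - p⁻¹ := sub_nonneg.2 (inv_le_one_of_one_le₀ hp)
  refine (ENNReal.inner_le_weight_mul_Lp_of_nonneg s hp w f).trans ?_
  gcongr
  · exact ENNReal.sum_le_tsum s
  · exact ENNReal.sum_le_tsum s

/-- Jensen's inequality for powers and probability measures. -/
lemma lintegral_rpow_le {X : Type*} [MeasurableSpace X] (μ : Measure X) [IsProbabilityMeasure μ]
    {p : ℝ} (hp : 1 ≤ p) {f : X → ℝ≥0∞} (hf : AEMeasurable f μ) :
    (∫⁻ x, f x ∂μ) ^ p ≤ ∫⁻ x, f x ^ p ∂μ := by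
  rcases hp.eq_or_lt with rfl | hp1
  · simp
  have hc := Real.HolderConjugate.conjExponent hp1
  have h := ENNReal.lintegral_mul_le_Lp_mul_Lq μ hc hf (g := fun _ => 1) aemeasurable_const
  simp only [Pi.mul_apply, mul_one, ENNReal.one_rpow, lintegral_one, measure_univ] at h
  calc (∫⁻ x, f x ∂μ) ^ p ≤ ((∫⁻ x, f x ^ p ∂μ) ^ (1 / p)) ^ p := by gcongr
    _ = ∫⁻ x, f x ^ p ∂μ := by
        rw [← ENNReal.rpow_mul, one_div_mul_cancel (by positivity), ENNReal.rpow_one]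

/-- Change of measure by Hölder's inequality. -/
lemma lintegral_enorm_rpow_le_densityNorm {X : Type*} [MeasurableSpace X] (μ ν : Measure X)
    [IsFiniteMeasure μ] [IsFiniteMeasure ν] {p : ℝ} (hp : 1 ≤ p) {q : ℝ≥0∞} (hq : 1 ≤ q)
    (hd : densityNorm q μ ν ≠ ⊤) {f : X → ℝ} (hf : Measurable f) :
    ∫⁻ x, ‖f x‖ₑ ^ p ∂μ ≤ densityNorm q μ ν * eLpNorm f (ENNReal.ofReal p * q) ν ^ p := by
  have hp0 : 0 < p := by linarith
  -- Finiteness of the density norm is essential: otherwise the right-hand side may be `∞ * 0 = 0`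
  -- for an `f` that vanishes only `ν`-almost everywhere.
  have hac : μ ≪ ν := by
    by_contra h
    exact hd (if_neg h)
  have hconj : ENNReal.HolderConjugate q.conjExponent q :=
    (ENNReal.HolderConjugate.conjExponent hq).symm
  have hlt : ∀ᵐ x ∂ν, μ.rnDeriv ν x < ⊤ := μ.rnDeriv_lt_top ν
  rw [densityNorm, if_pos hac, ← lintegral_rnDeriv_mul hac (hf.enorm.pow_const p).aemeasurable]
  have h1 : ∫⁻ x, μ.rnDeriv ν x * ‖f x‖ₑ ^ p ∂ν =
      eLpNorm ((fun x => (μ.rnDeriv ν x).toReal) • fun x => ‖f x‖ ^ p) 1 ν := by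
    rw [eLpNorm_one_eq_lintegral_enorm]
    refine lintegral_congr_ae ?_
    filter_upwards [hlt] with x hx
    rw [Pi.smul_apply', smul_eq_mul, enorm_mul, Real.enorm_of_nonneg ENNReal.toReal_nonneg,
      ENNReal.ofReal_toReal hx.ne, Real.enorm_rpow_of_nonneg (norm_nonneg _) hp0.le, enorm_norm]
  have h2 : eLpNorm (μ.rnDeriv ν) q.conjExponent ν =
      eLpNorm (fun x => (μ.rnDeriv ν x).toReal) q.conjExponent ν := by
    refine eLpNorm_congr_enorm_ae ?_
    filter_upwards [hlt] with x hx
    rw [Real.enorm_of_nonneg ENNReal.toReal_nonneg, ENNReal.ofReal_toReal hx.ne]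
    rfl
  rw [h1, h2, mul_comm (ENNReal.ofReal p) q, ← eLpNorm_norm_rpow f hp0]
  exact eLpNorm_smul_le_mul_eLpNorm (hf.norm.pow_const p).aestronglyMeasurable
    (Measure.measurable_rnDeriv μ ν).ennreal_toReal.aestronglyMeasurable

/-- Weighted Cauchy–Schwarz inequality. -/
lemma ENNReal.sum_mul_le_sqrt {ι : Type*} (s : Finset ι) {r : ℝ} (hr : r ∈ Set.Icc (0 : ℝ) 1)
    (p : ℝ) (h : ℝ≥0∞) (α B N : ι → ℝ≥0∞) :
    ∑ j ∈ s, α j * (h * B j) * N j ^ p ≤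
      (h ^ 2 * ∑ j ∈ s, α j ^ (2 * (1 - r)) * B j ^ 2) ^ (1 / 2 : ℝ) *
        (∑ j ∈ s, α j ^ (2 * r) * N j ^ (2 * p)) ^ (1 / 2 : ℝ) := by
  have h2 (x : ℝ≥0∞) (t : ℝ) : (x ^ t) ^ (2 : ℝ) = x ^ (2 * t) := by
    rw [← ENNReal.rpow_mul, mul_comm]
  have := ENNReal.inner_le_Lp_mul_Lq s (fun j => α j ^ (1 - r) * (h * B j))
    (fun j => α j ^ r * N j ^ p) Real.HolderConjugate.two_two
  simp only [ENNReal.mul_rpow_of_nonneg _ _ zero_le_two, h2] at this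
  refine le_trans (le_of_eq ?_) (this.trans (le_of_eq ?_))
  · refine Finset.sum_congr rfl fun j _ => ?_
    -- Both exponents are nonnegative because `r ∈ [0, 1]`, so the splitting holds even where `α j`
    -- is `0` or `∞`.
    have hα : α j = α j ^ (1 - r) * α j ^ r := by
      rw [← ENNReal.rpow_add_of_nonneg _ _ (by linarith [hr.2]) hr.1, sub_add_cancel,
        ENNReal.rpow_one]
    conv_lhs => rw [hα]
    ring
  · congr 2
    rw [Finset.mul_sum]
    refine Finset.sum_congr rfl fun j _ => ?_
    rw [ENNReal.rpow_two, ENNReal.rpow_two]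
    ring

/-- Jensen is used twice: over the index with weights `w`, leaving the mass to the power `p - 1`,
and under each Markov kernel. -/
lemma lintegral_tsum_rpow_le {X ι : Type*} [MeasurableSpace X] [Countable ι] (ρ : Measure X)
    {p : ℝ} (hp : 1 ≤ p) (w : ι → ℝ≥0∞) (κ : ι → Kernel X X) [∀ i, IsMarkovKernel (κ i)]
    {F : ι → X → ℝ≥0∞} (hF : ∀ i, Measurable (F i)) :
    ∫⁻ x, (∑' i, w i * ∫⁻ z, F i z ∂(κ i x)) ^ p ∂ρ ≤
      (∑' i, w i) ^ (p - 1) * ∑' i, w i * ∫⁻ z, F i z ^ p ∂(ρ.bind (κ i)) := by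
  have hp0 : 0 < p := by linarith
  have hm (i : ι) : Measurable fun x => ∫⁻ z, F i z ^ p ∂(κ i x) :=
    ((hF i).pow_const p).lintegral_kernel
  calc ∫⁻ x, (∑' i, w i * ∫⁻ z, F i z ∂(κ i x)) ^ p ∂ρ
      ≤ ∫⁻ x, (∑' i, w i) ^ (p - 1) * ∑' i, w i * ∫⁻ z, F i z ^ p ∂(κ i x) ∂ρ := by
        refine lintegral_mono fun x => ?_
        calc _ ≤ ((∑' i, w i) ^ (1 - p⁻¹) *
                (∑' i, w i * (∫⁻ z, F i z ∂(κ i x)) ^ p) ^ p⁻¹) ^ p :=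
              ENNReal.rpow_le_rpow (ENNReal.tsum_weight_mul_le hp w _) hp0.le
          _ = (∑' i, w i) ^ (p - 1) * ∑' i, w i * (∫⁻ z, F i z ∂(κ i x)) ^ p := by
              rw [ENNReal.mul_rpow_of_nonneg _ _ hp0.le, ← ENNReal.rpow_mul, ← ENNReal.rpow_mul,
                inv_mul_cancel₀ hp0.ne', ENNReal.rpow_one, sub_mul, one_mul,
                inv_mul_cancel₀ hp0.ne']
          _ ≤ _ := mul_le_mul_right (ENNReal.tsum_le_tsum fun i => mul_le_mul_right
              (lintegral_rpow_le _ hp (hF i).aemeasurable) _) _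
    _ = _ := by
        rw [lintegral_const_mul _ (Measurable.tsum fun i => (hm i).const_mul _),
          lintegral_tsum fun i => ((hm i).const_mul _).aemeasurable]
        congr 1
        refine tsum_congr fun i => ?_
        rw [lintegral_const_mul _ (hm i), Measure.lintegral_bind (Kernel.aemeasurable _)
          ((hF i).pow_const p).aemeasurable]

/-- `p`-th moment of a discounted superposition of finitely many functions, a constant, and two
families of Markov kernels. -/
lemma lintegral_rpow_superposition_le {X : Type*} [MeasurableSpace X] (ρ : Measure X)
    [IsProbabilityMeasure ρ] {p : ℝ} (hp : 1 ≤ p) (J : ℕ) (a w : ℕ → ℝ≥0∞) (v c : ℝ≥0∞)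
    {e : ℕ → X → ℝ≥0∞} (he : ∀ j < J, Measurable (e j)) (κ₁ κ₂ : ℕ → ℕ → Kernel X X)
    [∀ m j, IsMarkovKernel (κ₁ m j)] [∀ m j, IsMarkovKernel (κ₂ m j)] :
    ∫⁻ x, (∑' m, a m * (∑ j ∈ Finset.range J, w j *
        (∫⁻ z, e j z ∂(κ₁ m j x) + ∫⁻ z, e j z ∂(κ₂ m j x)) + 2 * (v * c))) ^ p ∂ρ ≤
      ((∑' m, a m) * (2 * (∑ j ∈ Finset.range J, w j + v))) ^ (p - 1) *
        (∑ j ∈ Finset.range J, w j * ∑' m, a m *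
          (∫⁻ z, e j z ^ p ∂(ρ.bind (κ₁ m j)) + ∫⁻ z, e j z ^ p ∂(ρ.bind (κ₂ m j))) +
        (∑' m, a m) * (2 * (v * c ^ p))) := by
  -- One index set for all terms: `none` is the constant, under the identity kernel with weight `2 *
  -- v`, and the Boolean selects `κ₁` or `κ₂`.
  let W : ℕ × Option (Fin J × Bool) → ℝ≥0∞ := fun i =>
    a i.1 * i.2.elim (2 * v) fun jb => w jb.1
  let κ : ℕ × Option (Fin J × Bool) → Kernel X X := fun i =>
    i.2.elim Kernel.id fun jb => bif jb.2 then κ₁ i.1 jb.1 else κ₂ i.1 jb.1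
  let F : ℕ × Option (Fin J × Bool) → X → ℝ≥0∞ := fun i =>
    i.2.elim (fun _ => c) fun jb => e jb.1
  have hκ (i) : IsMarkovKernel (κ i) := by
    rcases i with ⟨m, _ | ⟨j, _ | _⟩⟩
    · exact inferInstanceAs (IsMarkovKernel Kernel.id)
    · exact inferInstanceAs (IsMarkovKernel (κ₂ m j))
    · exact inferInstanceAs (IsMarkovKernel (κ₁ m j))
  have hF (i) : Measurable (F i) := by
    rcases i with ⟨m, _ | ⟨j, b⟩⟩
    · exact measurable_const
    · exact he j j.2
  have h := lintegral_tsum_rpow_le ρ hp W κ hF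
  have hprob (κ : Kernel X X) [IsMarkovKernel κ] : (ρ.bind κ) Set.univ = 1 := by
    rw [Measure.bind_apply .univ (Kernel.aemeasurable _)]
    simp
  simp only [ENNReal.tsum_prod', tsum_fintype, Fintype.sum_option, Fintype.sum_prod_type,
    Fintype.sum_bool, W, κ, F, Option.elim, cond_true, cond_false, lintegral_const,
    measure_univ, mul_one, hprob] at h
  have heq (m : ℕ) (y : ℝ≥0∞) (b₁ b₂ : ℕ → ℝ≥0∞) :
      a m * (2 * v) * y + ∑ j : Fin J, (a m * w j * b₁ j + a m * w j * b₂ j) =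
        a m * (∑ j ∈ Finset.range J, w j * (b₁ j + b₂ j) + 2 * (v * y)) := by
    rw [Finset.sum_range, mul_add, Finset.mul_sum, add_comm]
    congr 1
    · exact Finset.sum_congr rfl fun j _ => by ring
    · ring
  have hW : ∑' m, (a m * (2 * v) + ∑ j : Fin J, (a m * w j + a m * w j)) =
      (∑' m, a m) * (2 * (∑ j ∈ Finset.range J, w j + v)) := by
    rw [← ENNReal.tsum_mul_right]
    refine tsum_congr fun m => ?_
    have := heq m 1 (fun _ => 1) fun _ => 1
    simp only [mul_one] at this
    rw [this, one_add_one_eq_two, ← Finset.sum_mul, mul_comm _ 2, ← mul_add]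
  have hT (B₁ B₂ : ℕ → ℕ → ℝ≥0∞) (y : ℝ≥0∞) :
      ∑' m, a m * (∑ j ∈ Finset.range J, w j * (B₁ m j + B₂ m j) + 2 * (v * y)) =
        ∑ j ∈ Finset.range J, w j * ∑' m, a m * (B₁ m j + B₂ m j) +
          (∑' m, a m) * (2 * (v * y)) := by
    simp only [mul_add (a _) (Finset.sum _ _), Finset.mul_sum]
    rw [ENNReal.tsum_add, ENNReal.tsum_mul_right, Summable.tsum_finsetSum
      fun _ _ => ENNReal.summable]
    congr 1
    refine Finset.sum_congr rfl fun j _ => ?_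
    rw [← ENNReal.tsum_mul_left]
    exact tsum_congr fun m => mul_left_comm _ _ _
  rw [hW] at h
  calc _ = _ := lintegral_congr fun x => by
        congr 1
        exact tsum_congr fun m => (heq m c (fun j => ∫⁻ z, e j z ∂(κ₁ m j x))
          fun j => ∫⁻ z, e j z ∂(κ₂ m j x)).symm
    _ ≤ _ := h
    _ = _ := by
        rw [← hT]
        congr 1
        exact tsum_congr fun m => heq m (c ^ p) (fun j => ∫⁻ z, e j z ^ p ∂(ρ.bind (κ₁ m j)))
          fun j => ∫⁻ z, e j z ^ p ∂(ρ.bind (κ₂ m j))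

/-! ### Total weights, and the moment bound through concentrability coefficients. -/

namespace MDP

variable {S A : Type*} [MeasurableSpace S] [MeasurableSpace A] {M : MDP S A}

lemma tsum_ofReal_γ_pow {k : ℕ} (hk : 1 ≤ k) :
    ∑' m : ℕ, ENNReal.ofReal M.γ ^ (k * m) = ENNReal.ofReal (1 / (1 - M.γ ^ k)) := by
  have hlt : M.γ ^ k < 1 := γ_pow_lt_one hk
  simp only [pow_mul]
  rw [ENNReal.tsum_geometric, ← ENNReal.ofReal_pow M.γ_nonneg, ← ENNReal.ofReal_one,
    ← ENNReal.ofReal_sub _ (pow_nonneg M.γ_nonneg k),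
    ← ENNReal.ofReal_inv_of_pos (by linarith), one_div]

lemma sum_ofReal_γ_pow (J : ℕ) :
    ∑ j ∈ Finset.range J, ENNReal.ofReal M.γ ^ (J - j - 1) + ENNReal.ofReal M.γ ^ J =
      ENNReal.ofReal ((1 - M.γ ^ (J + 1)) / (1 - M.γ)) := by
  have h1 : ∑ j ∈ Finset.range J, ENNReal.ofReal M.γ ^ (J - j - 1) =
      ∑ j ∈ Finset.range J, ENNReal.ofReal M.γ ^ j := by
    rw [← Finset.sum_range_reflect (fun j => ENNReal.ofReal M.γ ^ j) J]
    exact Finset.sum_congr rfl fun j _ => by rw [Nat.sub_right_comm]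
  have hγ := M.γ_lt_one
  rw [h1, ← Finset.sum_range_succ]
  simp only [← ENNReal.ofReal_pow M.γ_nonneg]
  rw [← ENNReal.ofReal_sum_of_nonneg fun j _ => pow_nonneg M.γ_nonneg j,
    geom_sum_eq hγ.ne, ← neg_div_neg_eq, neg_sub, neg_sub]

/-- The first factor on the right is the total Jensen mass; `α_j (1 - γ^k) / 2` is the normalized
weight of one kernel at `m = 0`. -/
lemma ofReal_γ_pow_eq {k : ℕ} (hk : 1 ≤ k) (J j : ℕ) :
    ENNReal.ofReal M.γ ^ (J - j - 1) =
      ENNReal.ofReal (2 * ((1 - M.γ ^ (J + 1)) / (1 - M.γ)) / (1 - M.γ ^ k)) *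
        (ENNReal.ofReal (M.α J j) * ENNReal.ofReal ((1 - M.γ ^ k) / 2)) := by
  have h1 : 0 < 1 - M.γ ^ k := sub_pos.2 (γ_pow_lt_one hk)
  have h2 : 0 < 1 - M.γ ^ (J + 1) := sub_pos.2 (γ_pow_lt_one (by omega))
  have h3 : 0 < 1 - M.γ := sub_pos.2 M.γ_lt_one
  have h4 : 0 ≤ M.γ ^ (J - j - 1) := pow_nonneg M.γ_nonneg _
  rw [← ENNReal.ofReal_pow M.γ_nonneg, ← ENNReal.ofReal_mul (by unfold α; positivity),
    ← ENNReal.ofReal_mul (by positivity)]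
  congr 1
  unfold α
  field_simp

end MDP

namespace MDP

variable {S A : Type*} [MeasurableSpace S] [MeasurableSpace A] {M : MDP S A}

lemma α_pos (hγ : 0 < M.γ) (J j : ℕ) : 0 < M.α J j := by
  have h2 : 0 < 1 - M.γ ^ (J + 1) := sub_pos.2 (γ_pow_lt_one (by omega))
  have h3 : 0 < 1 - M.γ := sub_pos.2 M.γ_lt_one
  unfold α
  positivity

/-- Finiteness of `CVI` makes every concentrability coefficient in it finite. -/
lemma cVI_ne_top_of_CVI_ne_top (hγ : 0 < M.γ) {k : ℕ} (hk : 1 ≤ k) {πstar : Policy S A}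
    {ρ ν : Measure (S × A)} {J : ℕ} {r : ℝ} {q : ℝ≥0∞}
    (hC : M.CVI k πstar ρ ν J r q ≠ ⊤) (π : ℕ → Policy S A) {j : ℕ} (hj : j < J) (m : ℕ) :
    M.cVI₁ k q ρ ν πstar m (J / k - j / k) (k - j % k - 1) (π J) +
      M.cVI₂ k q ρ ν (m + 1) (k - j % k - 1) (J / k - j / k)
        (fun l => π (k * (j / k + l))) ≠ ⊤ := by
  intro htop
  refine hC ?_
  have h1 : 0 < (1 - M.γ ^ k) / 2 := by
    have : M.γ ^ k < 1 := γ_pow_lt_one hk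
    linarith
  have hsum : ∑' m : ℕ, ENNReal.ofReal (M.γ ^ (k * m)) *
      (M.cVI₁ k q ρ ν πstar m (J / k - j / k) (k - j % k - 1) (π J) +
        M.cVI₂ k q ρ ν (m + 1) (k - j % k - 1) (J / k - j / k)
          (fun l => π (k * (j / k + l)))) = ⊤ := by
    refine ENNReal.tsum_eq_top_of_eq_top ⟨m, ?_⟩
    -- Only a nonzero weight preserves `∞`; this is where `0 < γ` is needed.
    rw [htop, ENNReal.mul_top]
    exact (ENNReal.ofReal_pos.2 (pow_pos hγ _)).ne'
  unfold CVI
  rw [ENNReal.mul_eq_top]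
  refine Or.inl ⟨pow_ne_zero _ (ENNReal.ofReal_pos.2 h1).ne', ?_⟩
  refine top_unique (le_iSup_of_le π ?_)
  refine le_trans (le_of_eq ?_) (Finset.single_le_sum (fun _ _ => zero_le) (Finset.mem_range.2 hj))
  rw [hsum, ENNReal.top_pow two_ne_zero, ENNReal.mul_top]
  exact (ENNReal.rpow_pos (ENNReal.ofReal_pos.2 (α_pos hγ J j)) ENNReal.ofReal_ne_top).ne'

variable [Finite A] [Nonempty A] [MeasurableSingletonClass A]

/-- Bound on the `p`-th moment of the performance loss through the concentrability
coefficients. -/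
lemma lintegral_rpow_Qopt_sub_Qπ_le {Rmax : ℝ} (hR : ∀ x, |M.r x| ≤ Rmax) {p : ℝ} (hp : 1 ≤ p)
    {k : ℕ} (hk : 1 ≤ k) (D : ℕ) (ρ ν : Measure (S × A)) [IsProbabilityMeasure ρ]
    [IsProbabilityMeasure ν] {πstar : Policy S A} (hπstar : πstar.IsGreedy (M.Qopt k))
    {Q : ℕ → S × A → ℝ} (hQ : ∀ j ≤ k * D, BddMeasurable (Q j)) {π : ℕ → Policy S A}
    (hπ : ∀ d ≤ D, (π (k * d)).IsGreedy (Q (k * d))) {c₀ : ℝ}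
    (hc₀ : ∀ x, |M.Qopt k x - Q 0 x| ≤ c₀) {q : ℝ≥0∞} (hq : 1 ≤ q)
    (hfin : ∀ j < k * D, ∀ m,
      M.cVI₁ k q ρ ν πstar m (D - j / k) (k - j % k - 1) (π (k * D)) +
        M.cVI₂ k q ρ ν (m + 1) (k - j % k - 1) (D - j / k) (fun l => π (k * (j / k + l))) ≠ ⊤) :
    ∫⁻ x, ENNReal.ofReal (M.Qopt k x - M.Qπ k (π (k * D)) x) ^ p ∂ρ ≤
      (ENNReal.ofReal M.γ ^ k) ^ p *
      (ENNReal.ofReal (2 * ((1 - M.γ ^ (k * D + 1)) / (1 - M.γ)) / (1 - M.γ ^ k)) ^ p *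
        (∑ j ∈ Finset.range (k * D), ENNReal.ofReal (M.α (k * D) j) *
          (ENNReal.ofReal ((1 - M.γ ^ k) / 2) * ∑' m : ℕ, ENNReal.ofReal (M.γ ^ (k * m)) *
            (M.cVI₁ k q ρ ν πstar m (D - j / k) (k - j % k - 1) (π (k * D)) +
              M.cVI₂ k q ρ ν (m + 1) (k - j % k - 1) (D - j / k)
                (fun l => π (k * (j / k + l))))) *
          eLpNorm (M.err k Q j) (ENNReal.ofReal p * q) ν ^ p +
        ENNReal.ofReal M.γ ^ (k * D) * ENNReal.ofReal c₀ ^ p)) := by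
  have hp0 : 0 < p := by linarith
  set g := ENNReal.ofReal M.γ with hg
  set J := k * D with hJ
  set σ := ENNReal.ofReal (2 * ((1 - M.γ ^ (J + 1)) / (1 - M.γ)) / (1 - M.γ ^ k)) with hσ
  set c : ℕ → ℕ → ℝ≥0∞ := fun j m =>
    M.cVI₁ k q ρ ν πstar m (D - j / k) (k - j % k - 1) (π J) +
      M.cVI₂ k q ρ ν (m + 1) (k - j % k - 1) (D - j / k) (fun l => π (k * (j / k + l))) with hc
  have hγk : 0 < 1 - M.γ ^ k := sub_pos.2 (γ_pow_lt_one hk)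
  have hγ1 : 0 < 1 - M.γ := sub_pos.2 M.γ_lt_one
  have hγJ : 0 < 1 - M.γ ^ (J + 1) := sub_pos.2 (γ_pow_lt_one (by omega))
  have hγle : M.γ ^ (J + 1) ≤ M.γ :=
    (pow_le_pow_of_le_one M.γ_nonneg M.γ_lt_one.le (Nat.le_add_left 1 J)).trans_eq (pow_one _)
  have hε (j : ℕ) (hj : j < J) : Measurable (M.err k Q j) :=
    (bddMeasurable_err hR k (hQ j hj.le) (hQ (j + 1) hj)).measurable
  have hσ_eq : (∑' m : ℕ, g ^ (k * m)) *
      (2 * (∑ j ∈ Finset.range J, g ^ (J - j - 1) + g ^ J)) = σ := by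
    rw [hg, tsum_ofReal_γ_pow hk, sum_ofReal_γ_pow, ← ENNReal.ofReal_ofNat 2,
      ← ENNReal.ofReal_mul zero_le_two, ← ENNReal.ofReal_mul (by positivity), hσ]
    congr 1
    ring
  -- The normalized weight of the initial gap, `(1 - γ) γ^J / (1 - γ^(J+1))`, is relaxed to `γ^J`.
  have hσ_le : (∑' m : ℕ, g ^ (k * m)) * 2 ≤ σ := by
    rw [← hσ_eq, hg, sum_ofReal_γ_pow]
    gcongr
    refine le_mul_of_one_le_right zero_le ?_
    rw [ENNReal.one_le_ofReal, one_le_div hγ1]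
    linarith
  have hσp : σ ^ (p - 1) * σ = σ ^ p := by
    conv_rhs => rw [show p = p - 1 + 1 by ring]
    rw [ENNReal.rpow_add_of_nonneg _ _ (by linarith) zero_le_one, ENNReal.rpow_one]
  calc ∫⁻ x, ENNReal.ofReal (M.Qopt k x - M.Qπ k (π J) x) ^ p ∂ρ
      ≤ ∫⁻ x, (g ^ k) ^ p * (∑' m : ℕ, g ^ (k * m) *
        (∑ j ∈ Finset.range J, g ^ (J - j - 1) *
          (∫⁻ z, ‖M.err k Q j z‖ₑ ∂(M.errKernel₁ k πstar m (D - j / k) (k - j % k - 1) (π J) x) +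
            ∫⁻ z, ‖M.err k Q j z‖ₑ ∂(M.errKernel₂ k (m + 1) (k - j % k - 1) (j / k) (D - j / k)
              π x)) + 2 * (g ^ J * ENNReal.ofReal c₀))) ^ p ∂ρ := by
        refine lintegral_mono fun x => ?_
        rw [← ENNReal.mul_rpow_of_nonneg _ _ hp0.le]
        exact ENNReal.rpow_le_rpow (ofReal_Qopt_sub_Qπ_le_tsum hR hk D hπstar hQ hπ hc₀ x) hp0.le
    _ = (g ^ k) ^ p * ∫⁻ x, (∑' m : ℕ, g ^ (k * m) *
        (∑ j ∈ Finset.range J, g ^ (J - j - 1) *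
          (∫⁻ z, ‖M.err k Q j z‖ₑ ∂(M.errKernel₁ k πstar m (D - j / k) (k - j % k - 1) (π J) x) +
            ∫⁻ z, ‖M.err k Q j z‖ₑ ∂(M.errKernel₂ k (m + 1) (k - j % k - 1) (j / k) (D - j / k)
              π x)) + 2 * (g ^ J * ENNReal.ofReal c₀))) ^ p ∂ρ :=
        lintegral_const_mul' _ _ (ENNReal.rpow_ne_top_of_nonneg hp0.le
          (ENNReal.pow_ne_top ENNReal.ofReal_ne_top))
    _ ≤ (g ^ k) ^ p * (σ ^ (p - 1) *
        (∑ j ∈ Finset.range J, g ^ (J - j - 1) * ∑' m : ℕ, g ^ (k * m) *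
          (∫⁻ z, ‖M.err k Q j z‖ₑ ^ p
            ∂(ρ.bind (M.errKernel₁ k πstar m (D - j / k) (k - j % k - 1) (π J))) +
          ∫⁻ z, ‖M.err k Q j z‖ₑ ^ p
            ∂(ρ.bind (M.errKernel₂ k (m + 1) (k - j % k - 1) (j / k) (D - j / k) π))) +
        (∑' m : ℕ, g ^ (k * m)) * (2 * (g ^ J * ENNReal.ofReal c₀ ^ p)))) := by
        gcongr
        rw [← hσ_eq]
        exact lintegral_rpow_superposition_le ρ hp J (fun m => g ^ (k * m))
          (fun j => g ^ (J - j - 1)) (g ^ J) (ENNReal.ofReal c₀) (fun j hj => (hε j hj).enorm)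
          (fun m j => M.errKernel₁ k πstar m (D - j / k) (k - j % k - 1) (π J))
          (fun m j => M.errKernel₂ k (m + 1) (k - j % k - 1) (j / k) (D - j / k) π)
    _ ≤ (g ^ k) ^ p * (σ ^ (p - 1) * (σ * (∑ j ∈ Finset.range J, ENNReal.ofReal (M.α J j) *
          (ENNReal.ofReal ((1 - M.γ ^ k) / 2) * ∑' m : ℕ, ENNReal.ofReal (M.γ ^ (k * m)) *
            c j m) * eLpNorm (M.err k Q j) (ENNReal.ofReal p * q) ν ^ p +
        g ^ J * ENNReal.ofReal c₀ ^ p))) := by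
        gcongr
        rw [mul_add, Finset.mul_sum]
        refine add_le_add (Finset.sum_le_sum fun j hj => ?_) ?_
        · have hj' := Finset.mem_range.1 hj
          calc _ ≤ g ^ (J - j - 1) * ∑' m : ℕ, g ^ (k * m) *
                (c j m * eLpNorm (M.err k Q j) (ENNReal.ofReal p * q) ν ^ p) := by
                gcongr with m
                have hf := ENNReal.add_ne_top.1 (hfin j hj' m)
                simp only [hc, add_mul]
                rw [cVI₁_eq, cVI₂_eq] at hf ⊢
                exact add_le_add
                  (lintegral_enorm_rpow_le_densityNorm _ ν hp hq hf.1 (hε j hj'))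
                  (lintegral_enorm_rpow_le_densityNorm _ ν hp hq hf.2 (hε j hj'))
            _ = _ := by
                simp only [← mul_assoc, ENNReal.ofReal_pow M.γ_nonneg, ← hg]
                rw [ENNReal.tsum_mul_right, hg, ofReal_γ_pow_eq hk J j]
                ring
        · rw [← mul_assoc]
          gcongr
    _ = _ := by rw [← mul_assoc (σ ^ (p - 1)), hσp]

end MDP

/-! ### Assembly of the final bound. -/

theorem theorem5p1 {S A : Type*} [MeasurableSpace S] [MeasurableSpace A]
    [Finite A] [MeasurableSingletonClass A] (M : MDP S A)
    (Rmax : ℝ) (hR : ∀ x, |M.r x| ≤ Rmax)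
    (p : ℝ) (hp : 1 ≤ p) (k J : ℕ) (hk : 1 ≤ k) (hJ : 1 ≤ J) (hkJ : J % k = 0)
    (ρ ν : Measure (S × A)) [IsProbabilityMeasure ρ] [IsProbabilityMeasure ν]
    (Q : ℕ → S × A → ℝ) (hQmeas : ∀ j ≤ J, Measurable (Q j))
    (Qmax : ℝ) (hQmax : Qmax ≤ Rmax / (1 - M.γ)) (hQ : ∀ j ≤ J, ∀ x, |Q j x| ≤ Qmax)
    (πJ : Policy S A) (hπJ : πJ.IsGreedy (Q J))
    (πstar : Policy S A) (hπstar : πstar.IsGreedy (M.Qopt k))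
    (r : ℝ) (hr : r ∈ Set.Icc (0 : ℝ) 1) (q : ℝ≥0∞) (hq : 1 ≤ q)
    -- the product of the two factors below is not of the form `∞ · 0`, which would mean `∞` here
    (h_indet : M.CVI k πstar ρ ν J r q = ⊤ → M.errAgg p ν J (M.err k Q) r q ≠ 0) :
    eLpNorm (fun x => M.Qopt k x - M.Qπ k πJ x) (ENNReal.ofReal p) ρ ≤
      ENNReal.ofReal (2 * M.γ ^ k / ((1 - M.γ) * (1 - M.γ ^ k))) *
        (ENNReal.ofReal (2 / (1 - M.γ) * M.γ ^ ((J : ℝ) / p) * Rmax) +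
          M.CVI k πstar ρ ν J r q ^ (1 / (2 * p)) *
            M.errAgg p ν J (M.err k Q) r q ^ (1 / (2 * p))) := by
  obtain ⟨x₀⟩ : Nonempty (S × A) := nonempty_of_isProbabilityMeasure ρ
  have : Nonempty A := ⟨x₀.2⟩
  have hp0 : 0 < p := by linarith
  have hRnn : 0 ≤ Rmax := (abs_nonneg _).trans (hR x₀)
  have hγ1 : 0 < 1 - M.γ := sub_pos.2 M.γ_lt_one
  have hγk : 0 < 1 - M.γ ^ k := sub_pos.2 (MDP.γ_pow_lt_one hk)
  obtain ⟨D, rfl⟩ : ∃ D, J = k * D :=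
    ⟨J / k, (Nat.mul_div_cancel' (Nat.dvd_of_mod_eq_zero hkJ)).symm⟩
  have hJk : k * D / k = D := Nat.mul_div_cancel_left D hk
  have hQb (j : ℕ) (hj : j ≤ k * D) : BddMeasurable (Q j) := ⟨hQmeas j hj, Qmax, hQ j hj⟩
  have hΔ (x : S × A) : 0 ≤ M.Qopt k x - M.Qπ k πJ x := sub_nonneg.2 (MDP.Qπ_le_Qopt hR hk πJ x)
  -- Greedy policies of the earlier iterates are not given. Any choice will do, since `CVI` takes a
  -- supremum over sequences; only the last entry must be `πJ`.
  obtain ⟨π, hπ, hπeq⟩ : ∃ π : ℕ → Policy S A,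
      (∀ d ≤ D, (π (k * d)).IsGreedy (Q (k * d))) ∧ π (k * D) = πJ := by
    have (n : ℕ) : ∃ π : Policy S A, (n ≤ k * D → π.IsGreedy (Q n)) ∧ (n = k * D → π = πJ) := by
      by_cases hn : n = k * D
      · exact ⟨πJ, fun _ => hn ▸ hπJ, fun _ => rfl⟩
      · by_cases hn' : n ≤ k * D
        · obtain ⟨π, h⟩ := Policy.exists_isGreedy (hQmeas n hn')
          exact ⟨π, fun _ => h, fun h' => absurd h' hn⟩
        · exact ⟨πJ, fun h => absurd h hn', fun _ => rfl⟩
    choose π h1 h2 using this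
    exact ⟨π, fun d hd => h1 _ (Nat.mul_le_mul_left k hd), h2 _ rfl⟩
  have hc₀ (x : S × A) : |M.Qopt k x - Q 0 x| ≤ 2 / (1 - M.γ) * Rmax := by
    refine (abs_sub _ _).trans ((add_le_add (MDP.abs_Qopt_le hR hk x)
      ((hQ 0 (Nat.zero_le _) x).trans hQmax)).trans (le_of_eq ?_))
    ring
  -- For `γ = 0` the prefactor vanishes, so the loss must vanish too, and it does. Here weights in
  -- `CVI` can be zero, so its finiteness would not control the coefficients.
  rcases M.γ_nonneg.eq_or_lt with hγ0 | hγ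
  · have h0 : (fun x => M.Qopt k x - M.Qπ k πJ x) = 0 := by
      ext x
      refine le_antisymm ?_ (hΔ x)
      have := MDP.ofReal_Qopt_sub_Qπ_le hR hk hπstar (hQb _ le_rfl) hπJ x
      rw [← hγ0, ENNReal.ofReal_zero, zero_pow (by omega), zero_mul, zero_mul, add_zero] at this
      exact ENNReal.ofReal_eq_zero.1 (nonpos_iff_eq_zero.1 this)
    rw [h0, eLpNorm_zero]
    exact zero_le
  have hpre : 0 < 2 * M.γ ^ k / ((1 - M.γ) * (1 - M.γ ^ k)) := by positivity
  by_cases hC : M.CVI k πstar ρ ν (k * D) r q = ⊤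
  · have he : M.errAgg p ν (k * D) (M.err k Q) r q ^ (1 / (2 * p)) ≠ 0 := by
      intro h
      exact h_indet hC ((ENNReal.rpow_eq_zero_iff_of_pos (by positivity)).1 h)
    rw [hC, ENNReal.top_rpow_of_pos (by positivity), ENNReal.top_mul he, add_top,
      ENNReal.mul_top (ENNReal.ofReal_pos.2 hpre).ne']
    exact le_top
  have hfin (j : ℕ) (hj : j < k * D) (m : ℕ) :=
    MDP.cVI_ne_top_of_CVI_ne_top hγ hk hC π hj m
  rw [hJk] at hfin
  have hmain := MDP.lintegral_rpow_Qopt_sub_Qπ_le hR hp hk D ρ ν hπstar hQb hπ hc₀ hq hfin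
  have hCS := ENNReal.sum_mul_le_sqrt (Finset.range (k * D)) hr p
    (ENNReal.ofReal ((1 - M.γ ^ k) / 2)) (fun j => ENNReal.ofReal (M.α (k * D) j))
    (fun j => ∑' m : ℕ, ENNReal.ofReal (M.γ ^ (k * m)) *
      (M.cVI₁ k q ρ ν πstar m (D - j / k) (k - j % k - 1) (π (k * D)) +
        M.cVI₂ k q ρ ν (m + 1) (k - j % k - 1) (D - j / k) (fun l => π (k * (j / k + l)))))
    (fun j => eLpNorm (M.err k Q j) (ENNReal.ofReal p * q) ν)
  have hCVI : ENNReal.ofReal ((1 - M.γ ^ k) / 2) ^ 2 * ∑ j ∈ Finset.range (k * D),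
      ENNReal.ofReal (M.α (k * D) j) ^ (2 * (1 - r)) *
        (∑' m : ℕ, ENNReal.ofReal (M.γ ^ (k * m)) *
          (M.cVI₁ k q ρ ν πstar m (D - j / k) (k - j % k - 1) (π (k * D)) +
            M.cVI₂ k q ρ ν (m + 1) (k - j % k - 1) (D - j / k)
              (fun l => π (k * (j / k + l))))) ^ 2 ≤ M.CVI k πstar ρ ν (k * D) r q := by
    unfold MDP.CVI
    rw [hJk]
    gcongr
    exact le_iSup_of_le π le_rfl
  set C := M.CVI k πstar ρ ν (k * D) r q
  set E := M.errAgg p ν (k * D) (M.err k Q) r q with hE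
  set σ := ENNReal.ofReal (2 * ((1 - M.γ ^ (k * D + 1)) / (1 - M.γ)) / (1 - M.γ ^ k)) with hσ
  set g := ENNReal.ofReal M.γ with hg
  have hsum := hCS.trans (mul_le_mul_left (ENNReal.rpow_le_rpow hCVI (by norm_num)) _)
  rw [hπeq] at hmain hsum
  -- The factor `1 - γ^(J+1) ≤ 1` is dropped.
  have hprefactor : g ^ k * σ ≤
      ENNReal.ofReal (2 * M.γ ^ k / ((1 - M.γ) * (1 - M.γ ^ k))) := by
    rw [hg, hσ, ← ENNReal.ofReal_pow M.γ_nonneg, ← ENNReal.ofReal_mul (pow_nonneg M.γ_nonneg k)]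
    refine ENNReal.ofReal_le_ofReal ?_
    have : (1 - M.γ ^ (k * D + 1)) / (1 - M.γ) ≤ 1 / (1 - M.γ) :=
      div_le_div_of_nonneg_right (by linarith [pow_nonneg M.γ_nonneg (k * D + 1)]) hγ1.le
    calc _ ≤ M.γ ^ k * (2 * (1 / (1 - M.γ)) / (1 - M.γ ^ k)) := by gcongr
      _ = _ := by field_simp
  -- Jensen treats `γ^J` as a weight rather than as part of the function, so the final root turns it
  -- into `γ^(J/p)`.
  have hstart : (g ^ (k * D) * ENNReal.ofReal (2 / (1 - M.γ) * Rmax) ^ p) ^ p⁻¹ =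
      ENNReal.ofReal (2 / (1 - M.γ) * M.γ ^ (((k * D : ℕ) : ℝ) / p) * Rmax) := by
    rw [ENNReal.mul_rpow_of_nonneg _ _ (by positivity), ENNReal.rpow_rpow_inv hp0.ne',
      ← ENNReal.rpow_natCast, ← ENNReal.rpow_mul, hg, ENNReal.ofReal_rpow_of_pos hγ,
      ← ENNReal.ofReal_mul (by positivity), div_eq_mul_inv]
    congr 1
    ring_nf
  calc eLpNorm (fun x => M.Qopt k x - M.Qπ k πJ x) (ENNReal.ofReal p) ρ
      = (∫⁻ x, ENNReal.ofReal (M.Qopt k x - M.Qπ k πJ x) ^ p ∂ρ) ^ p⁻¹ := by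
        rw [eLpNorm_eq_lintegral_rpow_enorm_toReal (ENNReal.ofReal_pos.2 hp0).ne'
          ENNReal.ofReal_ne_top, ENNReal.toReal_ofReal hp0.le, one_div]
        congr 1
        exact lintegral_congr fun x => by rw [Real.enorm_of_nonneg (hΔ x)]
    _ ≤ ((g ^ k) ^ p * (σ ^ p * (C ^ (1 / 2 : ℝ) * E ^ (1 / 2 : ℝ) +
          g ^ (k * D) * ENNReal.ofReal (2 / (1 - M.γ) * Rmax) ^ p))) ^ p⁻¹ := by
        refine ENNReal.rpow_le_rpow (hmain.trans ?_) (by positivity)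
        gcongr
        exact hsum
    _ = g ^ k * σ * (C ^ (1 / 2 : ℝ) * E ^ (1 / 2 : ℝ) +
          g ^ (k * D) * ENNReal.ofReal (2 / (1 - M.γ) * Rmax) ^ p) ^ p⁻¹ := by
        rw [← mul_assoc, ENNReal.mul_rpow_of_nonneg _ _ (by positivity),
          ENNReal.mul_rpow_of_nonneg _ _ (by positivity), ENNReal.rpow_rpow_inv hp0.ne',
          ENNReal.rpow_rpow_inv hp0.ne']
    _ ≤ g ^ k * σ * ((C ^ (1 / 2 : ℝ) * E ^ (1 / 2 : ℝ)) ^ p⁻¹ +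
          (g ^ (k * D) * ENNReal.ofReal (2 / (1 - M.γ) * Rmax) ^ p) ^ p⁻¹) := by
        gcongr
        exact ENNReal.rpow_add_le_add_rpow _ _ (by positivity) (inv_le_one_of_one_le₀ hp)
    _ ≤ _ := by
        rw [hstart, ENNReal.mul_rpow_of_nonneg _ _ (by positivity), ← ENNReal.rpow_mul,
          ← ENNReal.rpow_mul, show (1 / 2 : ℝ) * p⁻¹ = 1 / (2 * p) by field_simp, add_comm]
        gcongr

end
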